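/- Let $p$ be an odd prime, $\mathbf{k}$ a field of characteristic $p$, and $\zeta=e^{2\pi i/p}$. Let $$S^\infty=\{w=(w_0,w_1,\dots)\in\mathbb{C}^\infty : w_k=0\text{ for }k\gg 0,\ \|w\|=1\},\qquad \tau(w_0,w_1,\dots)=(\zeta w_0,\zeta w_1,\dots).$$ A chain means a smooth singular chain with coefficients in $\mathbf{k}$; a singular simplex in $S^\infty$ is called smooth if it lies in some finite-dimensional sphere $S^{2N-1}\subset\mathbb{C}^N$ and extends to a smooth map from a neighbourhood of the standard simplex to $\mathbb{C}^N$, and a simplex in $S^\infty\times S^\infty$ is smooth if both of its components are. Consider the oriented cells $$\Delta_{2k}=\{w\in S^\infty : w_k\ge 0,\ w_j=0\text{ for }j>k\},\qquad \Delta_{2k+1}=\{w\in S^\infty : e^{-i\theta}w_k\ge 0\text{ for some }\theta\in[0,2\pi/p],\ w_j=0\text{ for }j>k\},$$ regarded as chains by means of the following triangulations. Let $e_j$ be the $j$-th unit vector, and write $[v_0,\dots,v_n]$ for the singular simplex $t\mapsto \sum_l t_lv_l/\|\sum_l t_lv_l\|$. Then $$\Delta_{2k}=\sum_{m\in\{0,\dots,p-1\}^k}[\zeta^{m_0}e_0,\zeta^{m_0+1}e_0,\dots,\zeta^{m_{k-1}}e_{k-1},\zeta^{m_{k-1}+1}e_{k-1},e_k],$$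 $$\Delta_{2k+1}=\sum_{m\in\{0,\dots,p-1\}^k}[\zeta^{m_0}e_0,\zeta^{m_0+1}e_0,\dots,\zeta^{m_{k-1}}e_{k-1},\zeta^{m_{k-1}+1}e_{k-1},e_k,\zeta e_k].$$ Let $\times$ be the cross product of chains given by the standard (shuffle) triangulation of a product of two simplices, let $\delta:S^\infty\to S^\infty\times S^\infty$ be the diagonal map, and let $\tau\times\tau$ be the diagonal action $(w_1,w_2)\mapsto(\tau w_1,\tau w_2)$; maps act on chains by push-forward. Then there is a sequence of chains $C_i$ of dimension $i$ in $S^\infty\times S^\infty$, $i\ge 0$, such that for every $i\ge 0$: if $i$ is odd, $$\partial C_{i+1}=\delta(\Delta_i)-\sum_{i_1+i_2=i}\Delta_{i_1}\times\Delta_{i_2}-\sum_{\substack{i_1+i_2=i\\ i_1\text{ odd}}}\Delta_{i_1}\times(\tau-1)\Delta_{i_2}-(\tau\times\tau-1)C_i,$$ and if $i$ is even, $$\partial C_{i+1}=\delta(\Delta_i)-\sum_{\substack{i_1+i_2=i\\ i_1,i_2\text{ even}}}\Delta_{i_1}\times\Delta_{i_2}-\sum_{\substack{i_1+i_2=i\\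 i_1\text{ odd}}}\ \sum_{0\le k<j\le p-1}\tau^k\Delta_{i_1}\times\tau^j\Delta_{i_2}-\bigl(1+\tau\times\tau+\cdots+(\tau\times\tau)^{p-1}\bigr)C_i.$$ -/

import Mathlib

/-!
Smooth singular chains on the infinite sphere and on its square, the cyclic action on it, the
standard equivariant cells as smooth singular chains, and the cross product of chains.
-/

open scoped ContDiff

noncomputable section

namespace SphereChains

/-- The infinite sphere: finitely supported complex sequences of `ℓ²`-norm one. -/
def SInf : Type :=
  {w : ℕ →₀ ℂ // (w.sum fun _ z => ‖z‖ ^ 2) = 1}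

/-- A map from the closed standard `n`-simplex to the infinite sphere is smooth if it lands in a
finite-dimensional sphere and its coordinates extend to smooth functions on an open neighbourhood
of the simplex. -/
def IsSmooth {n : ℕ} (σ : stdSimplex ℝ (Fin (n + 1)) → SInf) : Prop :=
  ∃ (N : ℕ) (U : Set (Fin (n + 1) → ℝ)) (f : ℕ → (Fin (n + 1) → ℝ) → ℂ),
    IsOpen U ∧ stdSimplex ℝ (Fin (n + 1)) ⊆ U ∧ (∀ k, ContDiffOn ℝ ∞ (f k) U) ∧
    (∀ t k, (σ t).1 k = f k t.1) ∧ ∀ t k, N ≤ k → (σ t).1 k = 0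

/-- Smooth singular `n`-simplices of the infinite sphere. -/
structure SmoothSimplex (n : ℕ) where
  toFun : stdSimplex ℝ (Fin (n + 1)) → SInf
  smooth : IsSmooth toFun

/-- Precomposition of a smooth simplex with the affine map of standard simplices that is given by
a map of vertices. -/
def SmoothSimplex.precomp {m n : ℕ} (σ : SmoothSimplex n) (f : Fin (m + 1) → Fin (n + 1)) :
    SmoothSimplex m where
  toFun t := σ.toFun (stdSimplex.map f t)
  smooth := by
    obtain ⟨N, U, g, hU, hsub, hg, hσ, hN⟩ := σ.smooth
    have hc : ContDiff ℝ ∞ (fun t : Fin (m + 1) → ℝ => FunOnFinite.linearMap ℝ ℝ f t) :=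
      (LinearMap.toContinuousLinearMap (FunOnFinite.linearMap ℝ ℝ f)).contDiff
    refine ⟨N, (fun t => FunOnFinite.linearMap ℝ ℝ f t) ⁻¹' U,
      fun k t => g k (FunOnFinite.linearMap ℝ ℝ f t), hU.preimage hc.continuous, ?_, ?_, ?_, ?_⟩
    · intro t ht
      exact hsub (stdSimplex.map f ⟨t, ht⟩).2
    · intro k
      exact (hg k).comp hc.contDiffOn (fun t ht => ht)
    · intro t k
      exact hσ _ k
    · intro t k hk
      exact hN _ k hk

/-- The root of unity `exp (2 π i / p)`. -/
def zeta (p : ℕ) : Circle := Circle.exp (2 * Real.pi / p)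

/-- The generator `τ` of the action of the cyclic group of order `p` on the infinite sphere:
multiplication of all coordinates by `exp (2 π i / p)`. -/
def rot (p : ℕ) (w : SInf) : SInf :=
  ⟨w.1.mapRange (fun z => (zeta p : ℂ) * z) (by simp), by
    rw [Finsupp.sum_mapRange_index (by simp)]
    simpa only [norm_mul, Circle.norm_coe, one_mul] using w.2⟩

/-- The action of `τ` on smooth simplices. -/
def SmoothSimplex.rot (p : ℕ) {n : ℕ} (σ : SmoothSimplex n) : SmoothSimplex n where
  toFun t := SphereChains.rot p (σ.toFun t)
  smooth := by
    obtain ⟨N, U, g, hU, hsub, hg, hσ, hN⟩ := σ.smooth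
    refine ⟨N, U, fun k t => (zeta p : ℂ) * g k t, hU, hsub, ?_, ?_, ?_⟩
    · intro k
      exact contDiffOn_const.mul (hg k)
    · intro t k
      simp [SphereChains.rot, hσ]
    · intro t k hk
      simp [SphereChains.rot, hN t k hk]

/-! ### Chains -/

/-- Smooth singular `n`-chains in the infinite sphere `S`. -/
abbrev Chain (k : Type*) [Field k] (n : ℕ) : Type _ :=
  SmoothSimplex n →₀ k

/-- Smooth singular `n`-chains in `S × S`. A smooth simplex in `S × S` is a pair of smooth
simplices in `S`. -/
abbrev ProdChain (k : Type*) [Field k] (n : ℕ) : Type _ :=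
  (SmoothSimplex n × SmoothSimplex n) →₀ k

variable {k : Type*} [Field k]

/-- The singular boundary operator of `S × S`. -/
def boundary {n : ℕ} : ProdChain k (n + 1) →ₗ[k] ProdChain k n :=
  ∑ i : Fin (n + 2), (-1 : k) ^ (i : ℕ) •
    Finsupp.lmapDomain k k (fun s : SmoothSimplex (n + 1) × SmoothSimplex (n + 1) =>
      (s.1.precomp i.succAbove, s.2.precomp i.succAbove))

/-- The action of `τ` on chains in `S`. -/
def tau (p : ℕ) {n : ℕ} : Module.End k (Chain k n) :=
  Finsupp.lmapDomain k k (SmoothSimplex.rot p)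

/-- The diagonal action of `τ`, that is `τ × τ`, on chains in `S × S`. -/
def tauTau (p : ℕ) {n : ℕ} : Module.End k (ProdChain k n) :=
  Finsupp.lmapDomain k k (Prod.map (SmoothSimplex.rot p) (SmoothSimplex.rot p))

/-- The push-forward of chains along the diagonal map of `S`. -/
def diag {n : ℕ} : Chain k n →ₗ[k] ProdChain k n :=
  Finsupp.lmapDomain k k (fun σ => (σ, σ))

/-- The simplices of top dimension `n = a + b` in the standard triangulation of the product of an
`a`-simplex and a `b`-simplex: strictly increasing sequences of `n + 1` pairs of vertices, that is,
monotone lattice paths from `(0, 0)` to `(a, b)`. -/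
abbrev LatticePath (a b n : ℕ) : Type :=
  {c : Fin (n + 1) → Fin (a + 1) × Fin (b + 1) // StrictMono c}

instance (a b n : ℕ) : Fintype (LatticePath a b n) := by
  classical exact inferInstance

/-- The number of unit squares below a lattice path (in the first coordinate direction, `area`
counts for each horizontal step the height at which it is taken). Its parity is the parity of the
corresponding shuffle. -/
def LatticePath.area {a b n : ℕ} (c : LatticePath a b n) : ℕ :=
  ∑ j : Fin n, (((c.1 j.succ).1 : ℕ) - ((c.1 j.castSucc).1 : ℕ)) * ((c.1 j.castSucc).2 : ℕ)

/-- The cross product of chains (the shuffle map): on simplices `σ`, `σ'` of dimensions `a`, `b` it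
is the signed sum of the simplices of the standard triangulation of the product of the two standard
simplices, mapped to `S × S` by the product map. -/
def cross {a b n : ℕ} (_h : a + b = n) (x : Chain k a) (y : Chain k b) : ProdChain k n :=
  x.sum fun σ r => y.sum fun σ' s =>
    ∑ c : LatticePath a b n, Finsupp.single
      (σ.precomp (fun j => (c.1 j).1), σ'.precomp (fun j => (c.1 j).2))
      ((-1 : k) ^ c.area * (r * s))

/-! ### The cells -/

/-- The linear combination of points of the sphere with coefficients `t`. -/
def comb {n : ℕ} (v : Fin (n + 1) → SInf) (t : Fin (n + 1) → ℝ) : ℕ →₀ ℂ :=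
  ∑ l, (t l : ℂ) • (v l).1

/-- The square of the `ℓ²`-norm. -/
def sqNorm (x : ℕ →₀ ℂ) : ℝ := x.sum fun _ z => ‖z‖ ^ 2

theorem sqNorm_pos {x : ℕ →₀ ℂ} (hx : x ≠ 0) : 0 < sqNorm x := by
  refine Finset.sum_pos (fun j hj => ?_) (Finsupp.support_nonempty_iff.2 hx)
  have : x j ≠ 0 := Finsupp.mem_support_iff.1 hj
  positivity

/-- The point `x / ‖x‖` of the sphere. -/
def radialProj (x : ℕ →₀ ℂ) (hx : x ≠ 0) : SInf :=
  ⟨x.mapRange (fun z => z / (Real.sqrt (sqNorm x) : ℂ)) (by simp), by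
    have h := sqNorm_pos hx
    rw [Finsupp.sum_mapRange_index (by simp)]
    simp only [norm_div, div_pow, Complex.norm_real, Real.norm_eq_abs, sq_abs, Real.sq_sqrt h.le]
    rw [Finsupp.sum, ← Finset.sum_div]
    exact div_self h.ne'⟩

/-- The geodesic simplex in the sphere with vertices `v`: the radial projection of the affine
simplex with these vertices, which has to avoid the origin. -/
def geodesic {n : ℕ} (v : Fin (n + 1) → SInf)
    (hv : ∀ t ∈ stdSimplex ℝ (Fin (n + 1)), comb v t ≠ 0) : SmoothSimplex n where
  toFun t := radialProj (comb v t.1) (hv t.1 t.2)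
  smooth := by
    classical
    let S : Finset ℕ := Finset.univ.biUnion fun l => (v l).1.support
    have hS : ∀ t j, j ∉ S → comb v t j = 0 := by
      intro t j hj
      simp only [comb, Finsupp.finsetSum_apply, Finsupp.smul_apply, smul_eq_mul]
      refine Finset.sum_eq_zero fun l _ => ?_
      have : (v l).1 j = 0 := by
        by_contra h
        exact hj (Finset.mem_biUnion.2 ⟨l, Finset.mem_univ _, Finsupp.mem_support_iff.2 h⟩)
      simp [this]
    have hq : ∀ t, sqNorm (comb v t) = ∑ j ∈ S, ‖comb v t j‖ ^ 2 := by
      intro t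
      refine Finsupp.sum_of_support_subset _ (fun j hj => ?_) _ (by simp)
      by_contra h
      exact (Finsupp.mem_support_iff.1 hj) (hS t j h)
    have hcoord : ∀ j, ContDiff ℝ ∞ (fun t : Fin (n + 1) → ℝ => comb v t j) := by
      intro j
      simp only [comb, Finsupp.finsetSum_apply, Finsupp.smul_apply, smul_eq_mul]
      refine ContDiff.sum fun l _ => ContDiff.mul ?_ contDiff_const
      exact Complex.ofRealCLM.contDiff.comp (contDiff_apply ℝ ℝ l)
    have hnorm : ContDiff ℝ ∞ (fun t : Fin (n + 1) → ℝ => sqNorm (comb v t)) := by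
      simp only [hq]
      exact ContDiff.sum fun j _ => (hcoord j).norm_sq ℝ
    obtain ⟨N, hN⟩ := S.exists_nat_subset_range
    refine ⟨N, {t | 0 < sqNorm (comb v t)},
      fun j t => comb v t j / (Real.sqrt (sqNorm (comb v t)) : ℂ), ?_, ?_, ?_, ?_, ?_⟩
    · exact isOpen_lt continuous_const hnorm.continuous
    · exact fun t ht => sqNorm_pos (hv t ht)
    · intro j
      simp only [div_eq_mul_inv, ← Complex.ofReal_inv]
      refine (hcoord j).contDiffOn.mul (Complex.ofRealCLM.contDiff.comp_contDiffOn ?_)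
      refine ContDiffOn.inv (hnorm.contDiffOn.sqrt fun t ht => ne_of_gt ht) ?_
      exact fun t ht => (Real.sqrt_pos.2 ht).ne'
    · intro t j
      simp [radialProj]
    · intro t j hj
      have : comb v t.1 j = 0 := hS _ _ fun h => by
        have := Finset.mem_range.1 (hN h)
        omega
      simp [radialProj, this]

/-- The point of the sphere whose only nonzero coordinate is `exp (2 π i m / p)`, in place `j`. -/
def vertex (p j m : ℕ) : SInf :=
  ⟨Finsupp.single j ((zeta p ^ m : Circle) : ℂ), by
    rw [Finsupp.sum_single_index (by simp)]
    simp only [Circle.norm_coe, one_pow]⟩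

/-- The vertices of a simplex of the cell of dimension `i`. The vertices number `2 j` and `2 j + 1`
are the points `ζ ^ (m j)` and `ζ ^ (m j + 1)` of the `j`-th coordinate circle, where `m` is
extended by zero to the last circle. -/
def cellVertex (p i : ℕ) (m : Fin (i / 2) → Fin p) (l : Fin (i + 1)) : SInf :=
  vertex p (l / 2) ((if h : (l : ℕ) / 2 < i / 2 then (m ⟨(l : ℕ) / 2, h⟩ : ℕ) else 0) + l % 2)

theorem cellVertex_comb_ne_zero (p : ℕ) (hp : 2 < p) (i : ℕ) (m : Fin (i / 2) → Fin p)
    (t : Fin (i + 1) → ℝ) (ht : t ∈ stdSimplex ℝ (Fin (i + 1))) :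
    comb (cellVertex p i m) t ≠ 0 := by
  classical
  let e : ℕ → ℕ := fun j => if h : j < i / 2 then (m ⟨j, h⟩ : ℕ) else 0
  let w : ℕ → ℂ := fun j => ((Circle.exp (-(Real.pi / p)) * (zeta p ^ e j)⁻¹ : Circle) : ℂ)
  let L : (ℕ →₀ ℂ) →ₗ[ℝ] ℝ := Finsupp.lsum ℝ fun j =>
    Complex.reLm.comp (LinearMap.mulLeft ℝ (w j))
  have hpp : (2 : ℝ) < p := by exact_mod_cast hp
  have hcos : 0 < Real.cos (Real.pi / p) := by
    apply Real.cos_pos_of_mem_Ioo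
    constructor
    · have : 0 < Real.pi / p := by positivity
      linarith [Real.pi_pos]
    · exact div_lt_div_of_pos_left Real.pi_pos two_pos hpp
  have hL : ∀ l : Fin (i + 1), L (cellVertex p i m l).1 = Real.cos (Real.pi / p) := by
    intro l
    have h1 : L (cellVertex p i m l).1 =
        (w (l / 2) * ((zeta p ^ (e (l / 2) + l % 2) : Circle) : ℂ)).re := by
      simp only [cellVertex, vertex, L, e]
      rw [Finsupp.lsum_single]
      simp
    have h2 : w (l / 2) * ((zeta p ^ (e (l / 2) + l % 2) : Circle) : ℂ) =
        ((Circle.exp (-(Real.pi / p)) * zeta p ^ ((l : ℕ) % 2) : Circle) : ℂ) := by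
      rw [pow_add, ← Circle.coe_mul]
      congr 1
      rw [mul_assoc, inv_mul_cancel_left]
    rw [h1, h2]
    rcases Nat.mod_two_eq_zero_or_one l with h | h
    · rw [h, pow_zero, mul_one, Circle.coe_exp, Complex.exp_ofReal_mul_I_re, Real.cos_neg]
    · rw [h, pow_one, zeta, ← Circle.exp_add, Circle.coe_exp, Complex.exp_ofReal_mul_I_re]
      congr 1
      ring
  intro h0
  have h3 : L (comb (cellVertex p i m) t) = Real.cos (Real.pi / p) := by
    have h4 : comb (cellVertex p i m) t = ∑ l, t l • (cellVertex p i m l).1 := by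
      simp only [comb]
      refine Finset.sum_congr rfl fun l _ => ?_
      ext j
      simp
    rw [h4, map_sum]
    simp only [map_smul, hL, smul_eq_mul]
    rw [← Finset.sum_mul, ht.2, one_mul]
  rw [h0, map_zero] at h3
  exact hcos.ne h3

/-- The cell of dimension `i` as a smooth singular chain, for `p > 2`. The cell of dimension `2 k`
is the set of points with `w_k ≥ 0` and `w_j = 0` for `j > k`; the cell of dimension `2 k + 1` is
the set of points such that `w_k` has an argument in `[0, 2 π / p]` or is zero, and `w_j = 0` for
`j > k`. The circles in the first `k` coordinates are divided into arcs
`[ζ ^ m, ζ ^ (m + 1)]`, and the cell is triangulated by the joins of `k` such arcs with the point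
`1`, respectively with the arc `[1, ζ]`, of the circle in the `k`-th coordinate. The order of the
vertices induces the complex orientation of the first `k` coordinates, followed in the odd case by
the positive orientation of the arc; the boundary of the cell of dimension `2 k + 1` is `τ - 1`
applied to the cell of dimension `2 k`, and the boundary of the cell of dimension `2 k + 2` is
`1 + τ + ⋯ + τ ^ (p - 1)` applied to the cell of dimension `2 k + 1`. -/
def cell (k : Type*) [Field k] (p : ℕ) (hp : 2 < p) (i : ℕ) : Chain k i :=
  ∑ m : Fin (i / 2) → Fin p,
    Finsupp.single (geodesic (cellVertex p i m) (cellVertex_comb_ne_zero p hp i m)) 1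

end SphereChains

end

open SphereChains

/-! Let `N_i` be `τ - 1` for even `i` and the norm `1 + τ + ⋯ + τ ^ (p - 1)` for odd `i`, with `τ ×
τ` in place of `τ` on the product. The cells satisfy `∂Δ_{i+1} = N_i Δ_i`, as in the periodic
resolution of the cyclic group of order `p`, and the terms subtracted from `δ(Δ_i)` are the
classical diagonal approximation of that resolution. Hence the defect `D_i`, the diagonal of `Δ_i`
minus its approximation, satisfies `∂D_{i+1} = N_i D_i` (`listBoundary_listDefect`); this combines
the Leibniz rule `listBoundary_listCross` with the algebraic identity `diagApprox_cyclicOp`.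

What has to be solved is `∂C_{i+1} = D_i - N_{i+1} C_i`, starting from `C_0 = 0`. By induction the
right side is a cycle, since `N_i N_{i+1} = (τ × τ) ^ p - 1 = 0`. It involves only the coordinates
`0, …, i`, so it is filled by an explicit cone, with apex `(e_{i+1}, e_{i+1})` in a fresh coordinate
direction. No equivariance of the cones is needed.

The computation takes place on formal chains of vertex lists, augmented by the empty list, where the
cone formula has no exceptional case. `realizePair` transfers it to geodesic simplices. The transfer
respects faces, rotations and products on `Admissible` lists, whose vertices lie on one chosen arc
per coordinate circle: a real functional with constant value `cos (π / p) > 0` on the vertices keeps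
their convex hull away from the origin. All chains that occur are of this kind, and
`listShuffle_ofFn` matches the recursive shuffle product with the sum over lattice paths. -/

noncomputable section

namespace SphereChains

/-! ### The augmented complex of vertex lists: cones and shuffle products. -/

section ListComplex

variable {k : Type*} [Field k] {V W V' W' : Type*}

/-- Prepending a vertex to all simplices of a chain of vertex lists. -/
def listCons (c : V) : (List V →₀ k) →ₗ[k] (List V →₀ k) :=
  Finsupp.lmapDomain k k (List.cons c)

/-- The boundary of a simplex with given list of vertices, in the augmented complex. -/
def listFaces (k : Type*) [Field k] : List V → (List V →₀ k)
  | [] => 0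
  | c :: l => Finsupp.single l 1 - listCons c (listFaces k l)

/-- The augmented boundary operator on chains of vertex lists. -/
def listBoundary : (List V →₀ k) →ₗ[k] (List V →₀ k) :=
  Finsupp.linearCombination k (listFaces k)

theorem listFaces_nil (k : Type*) [Field k] : listFaces k ([] : List V) = 0 := rfl

theorem listFaces_cons (k : Type*) [Field k] (c : V) (l : List V) :
    listFaces k (c :: l) = Finsupp.single l 1 - listCons c (listFaces k l) := rfl

/-- The map of chains induced by a map of vertices. -/
def listMap (f : V → W) : (List V →₀ k) →ₗ[k] (List W →₀ k) :=
  Finsupp.lmapDomain k k (List.map f)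

/-- The chains of vertex lists of dimension `n`. -/
def listDeg (k : Type*) [Field k] (V : Type*) (n : ℕ) : Submodule k (List V →₀ k) :=
  Finsupp.supported k k {l | l.length = n + 1}

@[simp] theorem listCons_single (c : V) (l : List V) (r : k) :
    listCons c (Finsupp.single l r) = Finsupp.single (c :: l) r := by
  simp [listCons, Finsupp.mapDomain_single]

@[simp] theorem listMap_single (f : V → W) (l : List V) (r : k) :
    listMap f (Finsupp.single l r) = Finsupp.single (l.map f) r := by
  simp [listMap, Finsupp.mapDomain_single]

@[simp] theorem listBoundary_single_one (l : List V) :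
    listBoundary (Finsupp.single l (1 : k)) = listFaces k l := by
  simp [listBoundary]

theorem listMap_listCons (f : V → W) (c : V) (x : List V →₀ k) :
    listMap f (listCons c x) = listCons (f c) (listMap f x) := by
  induction x using Finsupp.induction_linear with
  | zero => simp
  | add x y hx hy => simp [hx, hy]
  | single l r => simp

theorem listMap_comp (f : V → W) (g : W → V') (x : List V →₀ k) :
    listMap g (listMap f x) = listMap (g ∘ f) x := by
  induction x using Finsupp.induction_linear with
  | zero => simp
  | add x y hx hy => simp [hx, hy]
  | single l r => simp

theorem listMap_id (x : List V →₀ k) : listMap id x = x := by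
  induction x using Finsupp.induction_linear with
  | zero => simp
  | add x y hx hy => simp [hx, hy]
  | single l r => simp

/-- A cone is a contracting homotopy. Thanks to the augmentation this also holds in dimension zero,
so a cycle `x` is the boundary of its cone. -/
theorem listBoundary_listCons (c : V) (x : List V →₀ k) :
    listBoundary (listCons c x) = x - listCons c (listBoundary x) := by
  induction x using Finsupp.induction_linear with
  | zero => simp
  | add x y hx hy => simp only [map_add, hx, hy]; abel
  | single l r =>
    rw [← mul_one r, ← smul_eq_mul, ← Finsupp.smul_single]
    simp [listFaces, smul_sub, -Finsupp.smul_single]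

theorem listFaces_map (f : V → W) (l : List V) :
    listFaces k (l.map f) = listMap f (listFaces k l) := by
  induction l with
  | nil => simp [listFaces]
  | cons c l ih => simp [listFaces, ih, listMap_listCons]

theorem listBoundary_listMap (f : V → W) (x : List V →₀ k) :
    listBoundary (listMap f x) = listMap f (listBoundary x) := by
  induction x using Finsupp.induction_linear with
  | zero => simp
  | add x y hx hy => simp [hx, hy]
  | single l r =>
    rw [← mul_one r, ← smul_eq_mul, ← Finsupp.smul_single]
    simp [listFaces_map, -Finsupp.smul_single]

/-- The shuffle product of two simplices, by recursion over the first step of a lattice path. -/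
def listShuffle (k : Type*) [Field k] : List V → List W → (List (V × W) →₀ k)
  | [], _ => 0
  | _ :: _, [] => 0
  | v :: l, w :: m =>
    (if l.length + m.length = 0 then Finsupp.single [(v, w)] 1 else 0) +
      listCons (v, w) (listShuffle k l (w :: m) + (-1 : k) ^ l.length • listShuffle k (v :: l) m)
  termination_by l m => l.length + m.length

/-- The cross product of chains of vertex lists. -/
def listCross : (List V →₀ k) →ₗ[k] (List W →₀ k) →ₗ[k] (List (V × W) →₀ k) :=
  Finsupp.linearCombination k fun l => Finsupp.linearCombination k (listShuffle k l)

@[simp] theorem listCross_single_one (l : List V) (m : List W) :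
    listCross (Finsupp.single l (1 : k)) (Finsupp.single m 1) = listShuffle k l m := by
  simp [listCross]

@[simp] theorem listShuffle_nil_left (m : List W) : listShuffle k ([] : List V) m = 0 := by
  rw [listShuffle]

@[simp] theorem listShuffle_nil_right (l : List V) : listShuffle k l ([] : List W) = 0 := by
  cases l <;> rw [listShuffle]

theorem listShuffle_cons (v : V) (w : W) (l : List V) (m : List W) :
    listShuffle k (v :: l) (w :: m) =
    (if l.length + m.length = 0 then Finsupp.single [(v, w)] 1 else 0) +
      listCons (v, w) (listShuffle k l (w :: m) + (-1 : k) ^ l.length • listShuffle k (v :: l) m) := by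
  rw [listShuffle]

-- The empty simplex is killed by the product, so the product is not a chain map of augmented
-- complexes in total degree zero: there the boundary of a point is the empty list, while both
-- Leibniz terms vanish. This is why total degree zero is excluded below.
@[simp] theorem listCross_nil_left (y : List W →₀ k) :
    listCross (Finsupp.single ([] : List V) (1 : k)) y = 0 := by
  induction y using Finsupp.induction_linear with
  | zero => simp
  | add x y hx hy => simp [hx, hy]
  | single l r => simp [listCross]

@[simp] theorem listCross_nil_right (x : List V →₀ k) :
    listCross x (Finsupp.single ([] : List W) (1 : k)) = 0 := by
  induction x using Finsupp.induction_linear with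
  | zero => simp
  | add x y hx hy => simp [hx, hy]
  | single l r => simp [listCross]

theorem listShuffle_map (f : V → V') (g : W → W') (l : List V) (m : List W) :
    listShuffle k (l.map f) (m.map g) = listMap (Prod.map f g) (listShuffle k l m) := by
  induction l, m using listShuffle.induct with
  | case1 => simp
  | case2 => simp
  | case3 v l w m h1 h2 =>
    simp only [List.map_cons] at h1 h2 ⊢
    rw [listShuffle_cons, listShuffle_cons, h1, h2, map_add (listMap _), listMap_listCons]
    simp only [List.length_map, map_add, map_smul, Prod.map_apply]
    congr 1
    split_ifs <;> simp

theorem listCross_listMap (f : V → V') (g : W → W') (x : List V →₀ k) (y : List W →₀ k) :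
    listCross (listMap f x) (listMap g y) = listMap (Prod.map f g) (listCross x y) := by
  induction x using Finsupp.induction_linear with
  | zero => simp
  | add x y hx hy => simp [hx, hy]
  | single l r =>
    induction y using Finsupp.induction_linear with
    | zero => simp
    | add x y hx hy => simp only [map_add, hx, hy]
    | single m s => simp [listCross, listShuffle_map]

/-- Cross product with a cone on the left, when no zero-dimensional corrections occur. -/
theorem listCross_cons_left (v : V) (w : W) (n : ℕ) (x : List V →₀ k)
    (hx : x ∈ Finsupp.supported k k {l : List V | l.length = n}) (m : List W)
    (h : n + m.length ≠ 0) :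
    listCross (listCons v x) (Finsupp.single (w :: m) 1) =
      listCons (v, w) (listCross x (Finsupp.single (w :: m) 1) +
        (-1 : k) ^ n • listCross (listCons v x) (Finsupp.single m 1)) := by
  rw [Finsupp.supported_eq_span_single] at hx
  induction hx using Submodule.span_induction with
  | mem x hx =>
    obtain ⟨l, hl, rfl⟩ := hx
    simp only [Set.mem_ofPred_eq] at hl
    rw [← hl] at h ⊢
    simp only [listCons_single, listCross_single_one, listShuffle_cons v w l m, if_neg h, zero_add]
  | zero => simp
  | add x y _ _ hx hy => simp only [map_add, LinearMap.add_apply, hx, hy, smul_add]; abel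
  | smul r x _ hx =>
    simp only [map_smul, LinearMap.smul_apply, hx, smul_add, map_add, smul_comm r]

theorem listCross_cons_right (v : V) (w : W) (n : ℕ) (y : List W →₀ k)
    (hy : y ∈ Finsupp.supported k k {l : List W | l.length = n}) (l : List V)
    (h : n + l.length ≠ 0) :
    listCross (Finsupp.single (v :: l) 1) (listCons w y) =
      listCons (v, w) (listCross (Finsupp.single l 1) (listCons w y) +
        (-1 : k) ^ l.length • listCross (Finsupp.single (v :: l) 1) y) := by
  rw [Finsupp.supported_eq_span_single] at hy
  induction hy using Submodule.span_induction with
  | mem x hx =>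
    obtain ⟨m, hm, rfl⟩ := hx
    simp only [Set.mem_ofPred_eq] at hm
    rw [add_comm] at h
    rw [← hm] at h
    simp only [listCons_single, listCross_single_one, listShuffle_cons v w l m, if_neg h, zero_add]
  | zero => simp
  | add x y _ _ hx hy => simp only [map_add, hx, hy, smul_add]; abel
  | smul r x _ hx =>
    simp only [map_smul, hx, smul_add, map_add, smul_comm r]

theorem listCons_mem (n : ℕ) (c : V) (x : List V →₀ k)
    (hx : x ∈ Finsupp.supported k k {l : List V | l.length = n}) :
    listCons c x ∈ listDeg k V n := by
  have := Finsupp.lmapDomain_supported k k (List.cons c) {l : List V | l.length = n}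
  have h2 : listCons c x ∈ Submodule.map (Finsupp.lmapDomain k k (List.cons c))
    (Finsupp.supported k k {l : List V | l.length = n}) := ⟨x, hx, rfl⟩
  rw [this] at h2
  refine Finsupp.supported_mono ?_ h2
  rintro _ ⟨l, hl, rfl⟩
  simpa using hl

theorem listFaces_mem (l : List V) (n : ℕ) (hl : l.length = n + 1) :
    listFaces k l ∈ Finsupp.supported k k {l : List V | l.length = n} := by
  induction l generalizing n with
  | nil => simp at hl
  | cons c l ih =>
    rw [listFaces]
    refine sub_mem (Finsupp.single_mem_supported _ _ (by simpa using hl)) ?_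
    cases n with
    | zero =>
      obtain rfl : l = [] := by simpa using hl
      simp [listFaces]
    | succ n => exact listCons_mem n c _ (ih n (by simpa using hl))

/-- The Leibniz rule for the shuffle product. -/
theorem listBoundary_listShuffle (l : List V) (m : List W) (v : V) (w : W)
    (h : l.length + m.length ≠ 0) :
    listBoundary (listShuffle k (v :: l) (w :: m)) =
      listCross (listFaces k (v :: l)) (Finsupp.single (w :: m) 1) +
        (-1 : k) ^ l.length • listCross (Finsupp.single (v :: l) 1) (listFaces k (w :: m)) := by
  induction hn : l.length + m.length using Nat.strong_induction_on generalizing l m v w with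
  | _ n ih =>
  subst hn
  rw [listShuffle_cons, if_neg h, zero_add, listBoundary_listCons]
  cases l with
  | nil =>
    cases m with
    | nil => simp at h
    | cons w' m =>
      simp only [listShuffle_nil_left, List.length_nil, pow_zero, one_smul, zero_add]
      rw [listFaces_cons k v, listFaces_cons k w, listFaces_nil]
      simp only [map_zero, sub_zero, listCross_nil_left, zero_add]
      rw [map_sub, listCross_single_one]
      congr 1
      -- For empty `m` the remaining shuffle is a single point, outside the range of the induction
      -- hypothesis.
      by_cases hm : m = []
      · subst hm
        simp [listFaces, listShuffle_cons]
      · have hm' : m.length ≠ 0 := by simpa using hm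
        rw [ih m.length (by simp) [] m v w' (by simpa using hm) (by simp),
          listCross_cons_right v w m.length _ (listFaces_mem (w' :: m) _ rfl) [] (by simpa using hm)]
        simp [listFaces]
  | cons v' l =>
    cases m with
    | nil =>
      simp only [listShuffle_nil_right, smul_zero, add_zero]
      rw [listFaces_cons k v, listFaces_cons k w [], listFaces_nil]
      simp only [map_zero, sub_zero, listCross_nil_right, smul_zero, add_zero]
      rw [map_sub, LinearMap.sub_apply, listCross_single_one]
      congr 1
      by_cases hl : l = []
      · subst hl
        simp [listFaces, listShuffle_cons]
      · rw [ih l.length (by simp) l [] v' w (by simpa using hl) (by simp),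
          listCross_cons_left v w l.length _ (listFaces_mem (v' :: l) _ rfl) [] (by simpa using hl)]
        simp [listFaces]
    | cons w' m =>
      rw [listFaces_cons k v (v' :: l), listFaces_cons k w (w' :: m)]
      simp only [map_add, map_sub, LinearMap.sub_apply, map_smul, listCross_single_one]
      rw [ih (l.length + (w' :: m).length) (by simp) l (w' :: m) v' w (by simp) rfl,
        ih ((v' :: l).length + m.length) (by simp) (v' :: l) m v w' (by simp) rfl,
        listCross_cons_left v w l.length _ (listFaces_mem (v' :: l) _ rfl) (w' :: m) (by simp),
        listCross_cons_right v w m.length _ (listFaces_mem (w' :: m) _ rfl) (v' :: l) (by simp)]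
      rw [listFaces_cons k v (v' :: l), listFaces_cons k w (w' :: m)]
      simp only [map_add, map_sub, LinearMap.sub_apply, map_smul, listCross_single_one, smul_add,
        smul_sub, List.length_cons, smul_smul, pow_succ]
      -- Two successive steps in the second factor contribute the same sign twice.
      have h2 : ((-1 : k) ^ l.length * -1) * ((-1) ^ l.length * -1) = 1 := by
        rw [← pow_succ, ← pow_add, ← two_mul]; simp
      simp only [h2, one_smul]
      module

/-- The Leibniz rule for the cross product. -/
theorem listBoundary_listCross (a b : ℕ) (h : a + b ≠ 0) (x : List V →₀ k) (y : List W →₀ k)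
    (hx : x ∈ listDeg k V a) (hy : y ∈ listDeg k W b) :
    listBoundary (listCross x y) =
      listCross (listBoundary x) y + (-1 : k) ^ a • listCross x (listBoundary y) := by
  rw [listDeg, Finsupp.supported_eq_span_single] at hx hy
  induction hx using Submodule.span_induction with
  | mem x hx =>
    obtain ⟨l, hl, rfl⟩ := hx
    induction hy using Submodule.span_induction with
    | mem x hx =>
      obtain ⟨m, hm, rfl⟩ := hx
      simp only [Set.mem_ofPred_eq] at hl hm
      obtain ⟨v, l, rfl⟩ := List.exists_cons_of_length_eq_add_one hl
      obtain ⟨w, m, rfl⟩ := List.exists_cons_of_length_eq_add_one hm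
      simp only [List.length_cons, Nat.add_right_cancel_iff] at hl hm
      simp only [listCross_single_one, listBoundary_single_one]
      rw [listBoundary_listShuffle l m v w (by omega), hl]
    | zero => simp
    | add x y _ _ hx hy => simp only [map_add, hx, hy, smul_add]; abel
    | smul r x _ hx => simp only [map_smul, hx, smul_add, smul_comm r]
  | zero => simp
  | add x y _ _ hx hy => simp only [map_add, LinearMap.add_apply, hx, hy, smul_add]; abel
  | smul r x _ hx => simp only [map_smul, LinearMap.smul_apply, hx, smul_add, smul_comm r]

end ListComplex

/-! ### Algebra of the periodic resolution and its diagonal approximation. -/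

section CyclicOperators

variable {k : Type*} [Field k] {X Y Z : Type*} [AddCommGroup X] [Module k X]
  [AddCommGroup Y] [Module k Y] [AddCommGroup Z] [Module k Z]

/-- The differentials of the standard periodic resolution of the cyclic group of order `p` with
generator `f`: `f - 1` in even degrees and the norm `1 + f + ⋯ + f ^ (p - 1)` in odd degrees. -/
def cyclicOp (p n : ℕ) (f : Module.End k X) : Module.End k X :=
  if Even n then f - 1 else ∑ j ∈ Finset.range p, f ^ j

theorem cyclicOp_even {p n : ℕ} (hn : Even n) (f : Module.End k X) :
    cyclicOp p n f = f - 1 := if_pos hn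

theorem cyclicOp_odd {p n : ℕ} (hn : ¬ Even n) (f : Module.End k X) :
    cyclicOp p n f = ∑ j ∈ Finset.range p, f ^ j := if_neg hn

theorem cyclicOp_add_two (p n : ℕ) (f : Module.End k X) :
    cyclicOp p (n + 2) f = cyclicOp p n f := by
  simp [cyclicOp, Nat.even_add]

/-- In either order the product of the two operators is `f ^ p - 1`. -/
theorem cyclicOp_mul_succ (p n : ℕ) (f : Module.End k X) (hf : f ^ p = 1) (x : X) :
    cyclicOp p n f (cyclicOp p (n + 1) f x) = 0 := by
  rw [← Module.End.mul_apply]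
  by_cases hn : Even n
  · rw [cyclicOp_even hn, cyclicOp_odd (by simpa [Nat.even_add_one] using hn), mul_geom_sum, hf,
      sub_self, LinearMap.zero_apply]
  · rw [cyclicOp_odd hn, cyclicOp_even (by simpa [Nat.even_add_one] using hn), geom_sum_mul, hf,
      sub_self, LinearMap.zero_apply]

theorem map_pow_of_map (u : X →ₗ[k] Y) (f : Module.End k X) (g : Module.End k Y)
    (h : ∀ x, u (f x) = g (u x)) (j : ℕ) (x : X) : u ((f ^ j) x) = (g ^ j) (u x) := by
  induction j generalizing x with
  | zero => simp
  | succ j ih => rw [pow_succ, Module.End.mul_apply, ih, h, pow_succ, Module.End.mul_apply]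

theorem map_cyclicOp (p n : ℕ) (u : X →ₗ[k] Y) (f : Module.End k X) (g : Module.End k Y)
    (h : ∀ x, u (f x) = g (u x)) (x : X) : u (cyclicOp p n f x) = cyclicOp p n g (u x) := by
  by_cases hn : Even n
  · simp [cyclicOp_even hn, h]
  · simp [cyclicOp_odd hn, LinearMap.sum_apply, map_pow_of_map u f g h]

/-- Telescoping along the diagonals of the triangle `l < j`; this serves the case where both degrees
are odd. -/
theorem sum_triangle_diag {Z : Type*} [AddCommGroup Z] (G : ℕ → ℕ → Z) (p : ℕ) :
    ∑ j ∈ Finset.range p, ∑ l ∈ Finset.range j, (G (l + 1) (j + 1) - G l j) =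
      ∑ l ∈ Finset.range p, G l p - ∑ j ∈ Finset.range p, G 0 (j + 1) := by
  induction p with
  | zero => simp
  | succ p ih =>
    rw [Finset.sum_range_succ, ih, Finset.sum_range_succ' (fun l => G l (p + 1)),
      Finset.sum_range_succ (fun j => G 0 (j + 1)), Finset.sum_sub_distrib]
    abel

/-- Telescoping in `j` for fixed `l`; this serves the case of odd first and even second degree. -/
theorem sum_triangle_vert {Z : Type*} [AddCommGroup Z] (G : ℕ → ℕ → Z) (p : ℕ) :
    ∑ j ∈ Finset.range p, ∑ l ∈ Finset.range j, (G l (j + 1) - G l j) =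
      ∑ l ∈ Finset.range p, G l p - ∑ j ∈ Finset.range p, G j (j + 1) := by
  induction p with
  | zero => simp
  | succ p ih =>
    rw [Finset.sum_range_succ, ih, Finset.sum_range_succ (fun l => G l (p + 1)),
      Finset.sum_range_succ (fun j => G j (j + 1)), Finset.sum_sub_distrib]
    abel

/-- The equivariant approximation of the diagonal of the periodic resolution, in bidegree
`(a, b)`. -/
def diagApprox (p : ℕ) (S : X →ₗ[k] Y →ₗ[k] Z) (f : Module.End k X) (g : Module.End k Y)
    (a b : ℕ) (x : X) (y : Y) : Z :=
  if Even (a + b) then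
    if Even a then S x y else ∑ j ∈ Finset.range p, ∑ l ∈ Finset.range j, S ((f ^ l) x) ((g ^ j) y)
  else if Even a then S x y else S x (g y)

/-- This is the chain map property of the approximation, one parity class at a time. Whenever the
double sum over `l < j` enters, it telescopes along an edge or a diagonal of the triangle, and `g ^
p = 1` identifies the boundary terms where they wrap around. -/
theorem diagApprox_cyclicOp (p : ℕ) (S : X →ₗ[k] Y →ₗ[k] Z) (f : Module.End k X)
    (g : Module.End k Y) (h : Module.End k Z) (hS : ∀ x y, S (f x) (g y) = h (S x y))
    (hg : g ^ p = 1) (a b : ℕ) (x : X) (y : Y) :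
    diagApprox p S f g (a + 1) b (cyclicOp p a f x) y +
      (-1 : k) ^ a • diagApprox p S f g a (b + 1) x (cyclicOp p b g y) =
      cyclicOp p (a + b) h (diagApprox p S f g a b x y) := by
  have hpow : ∀ (j : ℕ) (x : X) (y : Y), (h ^ j) (S x y) = S ((f ^ j) x) ((g ^ j) y) := by
    intro j
    induction j with
    | zero => simp
    | succ j ih => intro x y; simp [pow_succ, ih, ← hS]
  by_cases ha : Even a <;> by_cases hb : Even b
  · have h1 : ¬ Even (a + 1 + b) := by grind
    have h2 : ¬ Even (a + (b + 1)) := by grind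
    have h3 : Even (a + b) := by grind
    have h4 : ¬ Even (a + 1) := by grind
    simp only [diagApprox, h1, h2, h3, h4, ha, if_true, if_false, cyclicOp_even ha,
      cyclicOp_even hb, cyclicOp_even h3, ha.neg_one_pow, one_smul, LinearMap.sub_apply, map_sub,
      Module.End.one_apply, hS]
    abel
  · have h1 : Even (a + 1 + b) := by grind
    have h2 : Even (a + (b + 1)) := by grind
    have h3 : ¬ Even (a + b) := by grind
    have h4 : ¬ Even (a + 1) := by grind
    simp only [diagApprox, h1, h2, h3, h4, ha, if_true, if_false, cyclicOp_even ha,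
      cyclicOp_odd hb, cyclicOp_odd h3, ha.neg_one_pow, one_smul, LinearMap.sub_apply, map_sub,
      Module.End.one_apply, LinearMap.sum_apply, map_sum, hpow]
    -- For fixed `j` the inner sum telescopes in `l`, which leaves the diagonal term and the term
    -- with `l = 0`.
    have h5 : ∀ j : ℕ, ∑ l ∈ Finset.range j, (S ((f ^ l) (f x)) ((g ^ j) y) - S ((f ^ l) x) ((g ^ j) y))
        = S ((f ^ j) x) ((g ^ j) y) - S x ((g ^ j) y) := by
      intro j
      have := Finset.sum_range_sub (fun l => S ((f ^ l) x) ((g ^ j) y)) j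
      simpa only [pow_succ, Module.End.mul_apply, pow_zero, Module.End.one_apply] using this
    simp only [h5, Finset.sum_sub_distrib]
    abel
  · have h1 : Even (a + 1 + b) := by grind
    have h2 : Even (a + (b + 1)) := by grind
    have h3 : ¬ Even (a + b) := by grind
    have h4 : Even (a + 1) := by grind
    have ha' : Odd a := by grind
    simp only [diagApprox, h1, h2, h3, h4, ha, if_true, if_false, cyclicOp_odd ha,
      cyclicOp_even hb, cyclicOp_odd h3, ha'.neg_one_pow, neg_smul, one_smul, LinearMap.sub_apply,
      map_sub, Module.End.one_apply, LinearMap.sum_apply, map_sum, hpow]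
    have h5 := sum_triangle_vert (fun l j => S ((f ^ l) x) ((g ^ j) y)) p
    simp only [pow_succ g, Module.End.mul_apply, hg, Module.End.one_apply] at h5
    rw [h5]
    abel
  · have h1 : ¬ Even (a + 1 + b) := by grind
    have h2 : ¬ Even (a + (b + 1)) := by grind
    have h3 : Even (a + b) := by grind
    have h4 : Even (a + 1) := by grind
    have ha' : Odd a := by grind
    simp only [diagApprox, h1, h2, h3, h4, ha, if_true, if_false, cyclicOp_odd ha,
      cyclicOp_odd hb, cyclicOp_even h3, ha'.neg_one_pow, neg_smul, one_smul, LinearMap.sub_apply,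
      Module.End.one_apply, LinearMap.sum_apply, map_sum, ← hS]
    have h5 := sum_triangle_diag (fun l j => S ((f ^ l) x) ((g ^ j) y)) p
    simp only [pow_succ', Module.End.mul_apply, hg, Module.End.one_apply, pow_zero] at h5
    rw [h5]
    abel

end CyclicOperators

/-! ### The cells as iterated joins with triangulated circles. -/

section ListCells

variable {k : Type*} [Field k] {V W : Type*}

theorem zeta_pow_self (p : ℕ) (hp : p ≠ 0) : zeta p ^ p = 1 := by
  have hp' : (p : ℝ) ≠ 0 := by exact_mod_cast hp
  apply Circle.ext
  rw [zeta, Circle.coe_pow, Circle.coe_exp, ← Complex.exp_nat_mul]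
  refine Eq.trans ?_ Complex.exp_two_pi_mul_I
  congr 1
  have hp'' : (p : ℂ) ≠ 0 := by exact_mod_cast hp
  push_cast
  field_simp

theorem vertex_add_self (p : ℕ) (hp : p ≠ 0) (j m : ℕ) :
    vertex p j (m + p) = vertex p j m := by
  apply Subtype.ext
  simp only [vertex, pow_add, zeta_pow_self p hp, mul_one]

theorem rot_vertex (p j m : ℕ) : rot p (vertex p j m) = vertex p j (m + 1) := by
  apply Subtype.ext
  simp [rot, vertex, pow_succ, mul_comm]

theorem rot_pow (p n : ℕ) (w : SInf) (j : ℕ) :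
    ((rot p)^[n] w).1 j = (zeta p : ℂ) ^ n * w.1 j := by
  induction n with
  | zero => simp
  | succ n ih => rw [Function.iterate_succ_apply', pow_succ', mul_assoc, ← ih]; simp [rot]

theorem rot_pow_self (p : ℕ) (hp : p ≠ 0) : (rot p)^[p] = id := by
  funext w
  apply Subtype.ext
  ext j
  rw [rot_pow, ← Circle.coe_pow, zeta_pow_self p hp]
  simp

theorem rot_pow_vertex (p j m n : ℕ) : (rot p)^[n] (vertex p j m) = vertex p j (m + n) := by
  induction n with
  | zero => rfl
  | succ n ih => rw [Function.iterate_succ_apply', ih, rot_vertex, add_assoc]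

/-- The endomorphism of chains of vertex lists that is induced by a map of vertices. -/
def listEnd (k : Type*) [Field k] (f : V → V) : Module.End k (List V →₀ k) := listMap f

theorem listEnd_pow (f : V → V) (n : ℕ) (x : List V →₀ k) :
    (listEnd k f ^ n) x = listMap f^[n] x := by
  induction n generalizing x with
  | zero => simp [listMap_id]
  | succ n ih =>
    rw [pow_succ, Module.End.mul_apply, ih, listEnd, listMap_comp, Function.iterate_succ]

theorem listEnd_pow_eq_one (f : V → V) (n : ℕ) (h : f^[n] = id) : listEnd k f ^ n = 1 := by
  refine LinearMap.ext fun x => ?_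
  rw [listEnd_pow, h, listMap_id, Module.End.one_apply]

/-- The join with the triangulated circle in the `s`-th coordinate. -/
def circleJoin (k : Type*) [Field k] (p s : ℕ) : Module.End k (List SInf →₀ k) :=
  ∑ m ∈ Finset.range p, listCons (vertex p s m) ∘ₗ listCons (vertex p s (m + 1))

theorem circleJoin_apply (p s : ℕ) (x : List SInf →₀ k) :
    circleJoin k p s x =
      ∑ m ∈ Finset.range p, listCons (vertex p s m) (listCons (vertex p s (m + 1)) x) := by
  simp [circleJoin, LinearMap.sum_apply]

/-- The triangulated circle is a cycle, since the endpoints of its arcs cancel cyclically, and its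
simplices have two vertices, so no sign appears. -/
theorem listBoundary_circleJoin (p : ℕ) (hp : p ≠ 0) (s : ℕ) (x : List SInf →₀ k) :
    listBoundary (circleJoin k p s x) = circleJoin k p s (listBoundary x) := by
  have h := Finset.sum_range_sub (fun m => listCons (vertex p s m) x) p
  have h0 := vertex_add_self p hp s 0
  rw [zero_add] at h0
  rw [h0, sub_self] at h
  simp only [circleJoin_apply, map_sum, listBoundary_listCons, map_sub]
  rw [← sub_eq_zero, ← h, ← Finset.sum_sub_distrib]
  refine Finset.sum_congr rfl fun m _ => ?_
  abel

theorem circleJoin_listEnd (p : ℕ) (hp : p ≠ 0) (s : ℕ) (x : List SInf →₀ k) :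
    circleJoin k p s (listEnd k (rot p) x) = listEnd k (rot p) (circleJoin k p s x) := by
  simp only [circleJoin_apply, listEnd, map_sum, listMap_listCons, rot_vertex]
  obtain ⟨q, rfl⟩ := Nat.exists_eq_succ_of_ne_zero hp
  rw [Finset.sum_range_succ', Finset.sum_range_succ]
  -- Rotation permutes the arcs cyclically: the arc starting at index `0` on the left is the last
  -- rotated arc on the right.
  congr 2
  · have := vertex_add_self _ hp s 0
    rw [← this, zero_add]
  · have := vertex_add_self _ hp s 1
    rw [zero_add, ← this, add_comm 1]

/-- The cell of dimension `i` of the sphere of sequences that are supported in `[s, ∞)`. -/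
def listCell (k : Type*) [Field k] (p : ℕ) : ℕ → ℕ → (List SInf →₀ k)
  | 0, s => Finsupp.single [vertex p s 0] 1
  | 1, s => Finsupp.single [vertex p s 0, vertex p s 1] 1
  | i + 2, s => circleJoin k p s (listCell k p i (s + 1))

theorem listBoundary_listCell_zero (p s : ℕ) :
    listBoundary (listCell k p 0 s) = Finsupp.single [] 1 := by
  simp [listCell, listFaces]

/-- Joining with a circle commutes with the boundary and with the rotation, so the formula passes
from `i` to `i + 2`. The case of the 2-cell uses that the boundary of a vertex is the empty list,
whose join with the circle is the circle itself, a sum of rotated arcs. -/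
theorem listBoundary_listCell (p : ℕ) (hp : p ≠ 0) (i s : ℕ) :
    listBoundary (listCell k p (i + 1) s) = cyclicOp p i (listEnd k (rot p)) (listCell k p i s) := by
  induction i using Nat.twoStepInduction generalizing s with
  | zero => simp [listCell, listFaces, cyclicOp, listEnd, rot_vertex]
  | one =>
    have h : listCell k p (1 + 1) s = circleJoin k p s (listCell k p 0 (s + 1)) := rfl
    rw [h, listBoundary_circleJoin p hp, listBoundary_listCell_zero, circleJoin_apply,
      cyclicOp_odd (by decide), LinearMap.sum_apply]
    simp [listEnd_pow, listCell, rot_pow_vertex, add_comm]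
  | more i ih _ =>
    rw [listCell, listBoundary_circleJoin p hp, ih, cyclicOp_add_two, listCell,
      map_cyclicOp p i _ _ _ (circleJoin_listEnd p hp s)]

end ListCells

/-! ### The defect of the diagonal approximation and its filling by cones. -/

section DiagonalChains

variable {k : Type*} [Field k] {V W : Type*}

theorem lmapDomain_mem_supported {α β : Type*} (f : α → β) {s : Set α} {t : Set β}
    (h : ∀ a ∈ s, f a ∈ t) {x : α →₀ k} (hx : x ∈ Finsupp.supported k k s) :
    Finsupp.lmapDomain k k f x ∈ Finsupp.supported k k t := by
  have h2 : Finsupp.lmapDomain k k f x ∈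
      (Finsupp.supported k k s).map (Finsupp.lmapDomain k k f) := ⟨x, hx, rfl⟩
  rw [Finsupp.lmapDomain_supported] at h2
  refine Finsupp.supported_mono ?_ h2
  rintro _ ⟨a, ha, rfl⟩
  exact h a ha

theorem listMap_mem_listDeg (f : V → W) {n : ℕ} {x : List V →₀ k} (hx : x ∈ listDeg k V n) :
    listMap f x ∈ listDeg k W n :=
  lmapDomain_mem_supported _ (fun l hl => by simpa using hl) hx

theorem listCell_mem_listDeg (p i s : ℕ) : listCell k p i s ∈ listDeg k SInf i := by
  induction i using Nat.twoStepInduction generalizing s with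
  | zero => exact Finsupp.single_mem_supported _ _ (by simp)
  | one => exact Finsupp.single_mem_supported _ _ (by simp)
  | more i ih _ =>
    rw [listCell, circleJoin_apply]
    exact Submodule.sum_mem _ fun m _ => listCons_mem _ _ _ (listCons_mem _ _ _ (ih (s + 1)))

/-- The equivariant diagonal approximation on the cells, in bidegree `(a, b)`. -/
def listDiagTerm (k : Type*) [Field k] (p a b : ℕ) (x y : List SInf →₀ k) :
    List (SInf × SInf) →₀ k :=
  diagApprox p listCross (listEnd k (rot p)) (listEnd k (rot p)) a b x y

/-- The indices `c`, `d` only select the formula and are kept fixed when the boundary lowers the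
degree of a factor; `diagApprox_cyclicOp` is stated with the same shifted indices. -/
theorem listBoundary_listDiagTerm (p a b c d : ℕ) (h : a + b ≠ 0) (x y : List SInf →₀ k)
    (hx : x ∈ listDeg k SInf a) (hy : y ∈ listDeg k SInf b) :
    listBoundary (listDiagTerm k p c d x y) = listDiagTerm k p c d (listBoundary x) y +
      (-1 : k) ^ a • listDiagTerm k p c d x (listBoundary y) := by
  have hL := fun x y hx hy => listBoundary_listCross (k := k) (V := SInf) (W := SInf) a b h x y hx hy
  simp only [listDiagTerm, diagApprox]
  split_ifs
  · exact hL _ _ hx hy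
  · simp only [map_sum, listEnd_pow]
    rw [Finset.smul_sum, ← Finset.sum_add_distrib]
    refine Finset.sum_congr rfl fun j _ => ?_
    rw [Finset.smul_sum, ← Finset.sum_add_distrib]
    refine Finset.sum_congr rfl fun l _ => ?_
    rw [hL _ _ (listMap_mem_listDeg _ hx) (listMap_mem_listDeg _ hy), listBoundary_listMap,
      listBoundary_listMap]
  · exact hL _ _ hx hy
  · rw [listEnd, hL _ _ hx (listMap_mem_listDeg _ hy), listBoundary_listMap]

theorem listDiagTerm_nil_left (p a b : ℕ) (y : List SInf →₀ k) :
    listDiagTerm k p a b (Finsupp.single [] 1) y = 0 := by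
  simp [listDiagTerm, diagApprox, listEnd_pow]

theorem listDiagTerm_nil_right (p a b : ℕ) (x : List SInf →₀ k) :
    listDiagTerm k p a b x (Finsupp.single [] 1) = 0 := by
  have h : listEnd k (rot p) (Finsupp.single [] 1) = Finsupp.single [] 1 := by simp [listEnd]
  simp [listDiagTerm, diagApprox, listEnd_pow, h]

/-- The difference of the diagonal of a cell and its cellular approximation. -/
def listDefect (k : Type*) [Field k] (p i : ℕ) : List (SInf × SInf) →₀ k :=
  listMap (fun v => (v, v)) (listCell k p i 0) -
    ∑ x ∈ Finset.HasAntidiagonal.antidiagonal i,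
      listDiagTerm k p x.1 x.2 (listCell k p x.1 0) (listCell k p x.2 0)

/-- The diagonal rotation of chains of lists of pairs. -/
def listRotRot (k : Type*) [Field k] (p : ℕ) : Module.End k (List (SInf × SInf) →₀ k) :=
  listEnd k (Prod.map (rot p) (rot p))

theorem listBoundary_listRotRot (p : ℕ) (x : List (SInf × SInf) →₀ k) :
    listBoundary (listRotRot k p x) = listRotRot k p (listBoundary x) :=
  listBoundary_listMap _ x

theorem listRotRot_pow_self (p : ℕ) (hp : p ≠ 0) : listRotRot k p ^ p = 1 := by
  refine listEnd_pow_eq_one _ _ ?_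
  rw [Prod.map_iterate, rot_pow_self p hp]
  rfl

/-- The diagonal commutes with boundary and rotation. For the approximation, the Leibniz terms from
bidegrees `(a + 1, b)` and `(a, b + 1)` are collected for each `a + b = i`. -/
theorem listBoundary_listDefect (p i : ℕ) (hp : p ≠ 0) :
    listBoundary (listDefect k p (i + 1)) = cyclicOp p i (listRotRot k p) (listDefect k p i) := by
  have hd : ∀ x : List SInf →₀ k, listMap (fun v => (v, v)) (listEnd k (rot p) x) =
      listRotRot k p (listMap (fun v => (v, v)) x) := by
    intro x
    simp only [listEnd, listRotRot, listMap_comp]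
    rfl
  have hterm : ∀ x ∈ Finset.HasAntidiagonal.antidiagonal (i + 1),
      listBoundary (listDiagTerm k p x.1 x.2 (listCell k p x.1 0) (listCell k p x.2 0)) =
      listDiagTerm k p x.1 x.2 (listBoundary (listCell k p x.1 0)) (listCell k p x.2 0) +
      (-1 : k) ^ x.1 •
        listDiagTerm k p x.1 x.2 (listCell k p x.1 0) (listBoundary (listCell k p x.2 0)) := by
    intro x hx
    have := Finset.HasAntidiagonal.mem_antidiagonal.1 hx
    exact listBoundary_listDiagTerm p _ _ _ _ (by omega) _ _ (listCell_mem_listDeg _ _ _)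
      (listCell_mem_listDeg _ _ _)
  rw [listDefect, listDefect, map_sub, map_sub, listBoundary_listMap, listBoundary_listCell p hp,
    map_cyclicOp p i _ _ _ hd, map_sum, map_sum, Finset.sum_congr rfl hterm,
    Finset.sum_add_distrib, Finset.Nat.sum_antidiagonal_succ, Finset.Nat.sum_antidiagonal_succ']
  congr 1
  -- The unpaired end terms contain the boundary of a 0-cell, which is the empty list, and vanish.
  simp only [listBoundary_listCell_zero, listDiagTerm_nil_left, listDiagTerm_nil_right, smul_zero,
    zero_add]
  rw [← Finset.sum_add_distrib]
  refine Finset.sum_congr rfl fun x hx => ?_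
  rw [listBoundary_listCell p hp, listBoundary_listCell p hp, ← Finset.HasAntidiagonal.mem_antidiagonal.1 hx]
  refine diagApprox_cyclicOp p _ _ _ _ ?_ ?_ _ _ _ _
  · exact listCross_listMap _ _
  · exact listEnd_pow_eq_one _ _ (rot_pow_self p hp)

theorem listDefect_zero (p : ℕ) : listDefect k p 0 = 0 := by
  simp [listDefect, listDiagTerm, diagApprox, listCell, listShuffle_cons]

/-- The chains that interpolate between the diagonal and its cellular approximation, obtained by
taking cones with vertices in new coordinate directions. -/
def listHomotopy (k : Type*) [Field k] (p : ℕ) : ℕ → (List (SInf × SInf) →₀ k)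
  | 0 => 0
  | i + 1 => listCons (vertex p (i + 1) 0, vertex p (i + 1) 0)
      (listDefect k p i - cyclicOp p (i + 1) (listRotRot k p) (listHomotopy k p i))

/-- The inductive obstruction vanishes: the two contributions of the previous defect cancel, and
what is left is a product of two consecutive cyclic operators. -/
theorem listBoundary_listDefect_sub (p i : ℕ) (hp : p ≠ 0) :
    listBoundary (listDefect k p i - cyclicOp p (i + 1) (listRotRot k p) (listHomotopy k p i))
      = 0 := by
  induction i with
  | zero => simp [listDefect_zero, listHomotopy]
  | succ i ih =>
    rw [map_sub, listBoundary_listDefect p i hp,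
      map_cyclicOp p _ listBoundary _ (listRotRot k p) (listBoundary_listRotRot p), listHomotopy,
      listBoundary_listCons, ih, map_zero, sub_zero, cyclicOp_add_two, map_sub]
    rw [sub_sub_cancel]
    exact cyclicOp_mul_succ p i _ (listRotRot_pow_self p hp) _

theorem listBoundary_listHomotopy (p i : ℕ) (hp : p ≠ 0) :
    listBoundary (listHomotopy k p (i + 1)) =
      listDefect k p i - cyclicOp p (i + 1) (listRotRot k p) (listHomotopy k p i) := by
  rw [listHomotopy, listBoundary_listCons, listBoundary_listDefect_sub p i hp, map_zero, sub_zero]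

end DiagonalChains

/-! ### Lattice paths decomposed by their first step. -/

section LatticePaths

/-- The path that starts with a horizontal step and goes on with the translate of `c`. -/
def LatticePath.consFst {a b n : ℕ} (c : LatticePath a b n) : LatticePath (a + 1) b (n + 1) :=
  ⟨Fin.cons (0, 0) fun j => ((c.1 j).1.succ, (c.1 j).2), by
    rw [Fin.strictMono_iff_lt_succ]
    intro j
    refine Fin.cases ?_ (fun j => ?_) j
    · simp [Prod.lt_iff]
    · have := c.2 (Fin.castSucc_lt_succ (i := j))
      rw [← Fin.succ_castSucc, Fin.cons_succ, Fin.cons_succ]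
      rw [Prod.lt_iff] at this ⊢
      simpa using this⟩

/-- The path that starts with a vertical step and goes on with the translate of `c`. -/
def LatticePath.consSnd {a b n : ℕ} (c : LatticePath a b n) : LatticePath a (b + 1) (n + 1) :=
  ⟨Fin.cons (0, 0) fun j => ((c.1 j).1, (c.1 j).2.succ), by
    rw [Fin.strictMono_iff_lt_succ]
    intro j
    refine Fin.cases ?_ (fun j => ?_) j
    · simp [Prod.lt_iff]
    · have := c.2 (Fin.castSucc_lt_succ (i := j))
      rw [← Fin.succ_castSucc, Fin.cons_succ, Fin.cons_succ]
      rw [Prod.lt_iff] at this ⊢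
      simpa using this⟩

/-- The coordinate sum increases strictly in each of the `n` steps and is bounded by `n = a + b`, so
every step raises it by exactly one. The proof counts up from the start and down from the end. -/
theorem LatticePath.rank {a b n : ℕ} (h : a + b = n) (c : LatticePath a b n) (j : Fin (n + 1)) :
    ((c.1 j).1 : ℕ) + ((c.1 j).2 : ℕ) = j := by
  have hlt : ∀ i j : Fin (n + 1), i < j →
      ((c.1 i).1 : ℕ) + ((c.1 i).2 : ℕ) < ((c.1 j).1 : ℕ) + ((c.1 j).2 : ℕ) := by
    intro i j hij
    have := c.2 hij
    rw [Prod.lt_iff] at this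
    simp only [Fin.lt_def, Fin.le_def] at this
    omega
  have h1 : ∀ m (hm : m < n + 1), m ≤ ((c.1 ⟨m, hm⟩).1 : ℕ) + ((c.1 ⟨m, hm⟩).2 : ℕ) := by
    intro m
    induction m with
    | zero => intro _; exact Nat.zero_le _
    | succ m ih =>
      intro hm
      have := ih (by omega)
      have := hlt ⟨m, by omega⟩ ⟨m + 1, hm⟩ (by simp)
      omega
  have h2 : ∀ m (hm : m < n + 1),
      ((c.1 ⟨n - m, by omega⟩).1 : ℕ) + ((c.1 ⟨n - m, by omega⟩).2 : ℕ) ≤ n - m := by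
    intro m
    induction m with
    | zero => intro _; have := (c.1 ⟨n - 0, by omega⟩).1.2; have := (c.1 ⟨n - 0, by omega⟩).2.2; omega
    | succ m ih =>
      intro hm
      have := ih (by omega)
      have := hlt ⟨n - (m + 1), by omega⟩ ⟨n - m, by omega⟩ (by simp; omega)
      omega
  have h3 := h1 j j.2
  have h4 := h2 (n - j) (by omega)
  have h5 : n - (n - (j : ℕ)) = j := by omega
  simp only [h5] at h4
  exact le_antisymm h4 h3

theorem LatticePath.apply_zero {a b n : ℕ} (h : a + b = n) (c : LatticePath a b n) :
    c.1 0 = (0, 0) := by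
  have := c.rank h 0
  simp at this
  ext <;> simp [this]

theorem LatticePath.consFst_injective {a b n : ℕ} :
    Function.Injective (LatticePath.consFst : LatticePath a b n → _) := by
  intro c d hcd
  apply Subtype.ext
  funext j
  have := congrFun (congrArg Subtype.val hcd) j.succ
  simpa [LatticePath.consFst, Prod.ext_iff] using this

theorem LatticePath.consSnd_injective {a b n : ℕ} :
    Function.Injective (LatticePath.consSnd : LatticePath a b n → _) := by
  intro c d hcd
  apply Subtype.ext
  funext j
  have := congrFun (congrArg Subtype.val hcd) j.succ
  simpa [LatticePath.consSnd, Prod.ext_iff] using this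

theorem LatticePath.exists_consFst {a b n : ℕ} (h : a + 1 + b = n + 1)
    (c : LatticePath (a + 1) b (n + 1)) (hc : (c.1 1).1 ≠ 0) :
    ∃ d : LatticePath a b n, d.consFst = c := by
  have hpos : ∀ j : Fin (n + 1), (c.1 j.succ).1 ≠ 0 := by
    intro j hj
    have : (c.1 1).1 ≤ (c.1 j.succ).1 := (c.2.monotone (Fin.succ_le_succ_iff.2 (Fin.zero_le j))).1
    rw [hj] at this
    exact hc (le_antisymm this (Fin.zero_le _))
  refine ⟨⟨fun j => ((c.1 j.succ).1.pred (hpos j), (c.1 j.succ).2), ?_⟩, ?_⟩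
  · intro i j hij
    have := c.2 (Fin.succ_lt_succ_iff.2 hij)
    rw [Prod.lt_iff] at this ⊢
    simpa using this
  · apply Subtype.ext
    funext j
    refine Fin.cases ?_ (fun j => ?_) j
    · simp [LatticePath.consFst, c.apply_zero h]
    · simp [LatticePath.consFst]

theorem LatticePath.exists_consSnd {a b n : ℕ} (h : a + (b + 1) = n + 1)
    (c : LatticePath a (b + 1) (n + 1)) (hc : (c.1 1).2 ≠ 0) :
    ∃ d : LatticePath a b n, d.consSnd = c := by
  have hpos : ∀ j : Fin (n + 1), (c.1 j.succ).2 ≠ 0 := by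
    intro j hj
    have : (c.1 1).2 ≤ (c.1 j.succ).2 := (c.2.monotone (Fin.succ_le_succ_iff.2 (Fin.zero_le j))).2
    rw [hj] at this
    exact hc (le_antisymm this (Fin.zero_le _))
  refine ⟨⟨fun j => ((c.1 j.succ).1, (c.1 j.succ).2.pred (hpos j)), ?_⟩, ?_⟩
  · intro i j hij
    have := c.2 (Fin.succ_lt_succ_iff.2 hij)
    rw [Prod.lt_iff] at this ⊢
    simpa using this
  · apply Subtype.ext
    funext j
    refine Fin.cases ?_ (fun j => ?_) j
    · simp [LatticePath.consSnd, c.apply_zero h]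
    · simp [LatticePath.consSnd]

theorem sum_sub_succ_of_monotone (n : ℕ) (f : Fin (n + 1) → ℕ) (hf : Monotone f) :
    ∑ j : Fin n, (f j.succ - f j.castSucc) = f (Fin.last n) - f 0 := by
  induction n with
  | zero => simp
  | succ n ih =>
    rw [Fin.sum_univ_castSucc]
    have := ih (fun j => f j.castSucc) (fun i j hij => hf (by simpa using hij))
    simp only [← Fin.succ_castSucc] at this
    rw [this]
    have h1 : f 0 ≤ f (Fin.last n).castSucc := hf (Fin.zero_le _)
    have h2 : f (Fin.last n).castSucc ≤ f (Fin.last (n + 1)) := hf (Fin.le_last _)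
    rw [Fin.succ_last, Fin.castSucc_zero]
    rw [add_comm]
    exact Nat.sub_add_sub_cancel h2 h1

theorem LatticePath.area_consFst {a b n : ℕ} (c : LatticePath a b n) :
    c.consFst.area = c.area := by
  rw [LatticePath.area, Fin.sum_univ_succ]
  simp [LatticePath.consFst, LatticePath.area]

/-- An initial vertical step lifts each of the `a` horizontal steps by one; this is the source of
the sign in the shuffle recursion. -/
theorem LatticePath.area_consSnd {a b n : ℕ} (h : a + b = n) (c : LatticePath a b n) :
    c.consSnd.area = c.area + a := by
  have h1 := sum_sub_succ_of_monotone n (fun j => ((c.1 j).1 : ℕ))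
    (fun i j hij => (c.2.monotone hij).1)
  have h2 := c.rank h (Fin.last n)
  have h3 : ((c.1 (Fin.last n)).1 : ℕ) = a := by
    have := (c.1 (Fin.last n)).1.2
    have := (c.1 (Fin.last n)).2.2
    simp only [Fin.val_last] at h2
    omega
  rw [h3, c.apply_zero h] at h1
  rw [LatticePath.area, Fin.sum_univ_succ]
  simp [LatticePath.consSnd, LatticePath.area, mul_add, Finset.sum_add_distrib] at h1 ⊢
  exact h1

variable {M : Type*} [AddCommMonoid M]

theorem LatticePath.sum_succ_zero {a n : ℕ} (h : a = n)
    (F : LatticePath (a + 1) 0 (n + 1) → M) :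
    ∑ c, F c = ∑ c : LatticePath a 0 n, F c.consFst := by
  refine (Function.Bijective.sum_comp ⟨LatticePath.consFst_injective, fun c => ?_⟩ F).symm
  refine c.exists_consFst (by omega) fun h0 => ?_
  have := c.rank (by omega) 1
  simp [h0] at this

theorem LatticePath.sum_zero_succ {b n : ℕ} (h : b = n)
    (F : LatticePath 0 (b + 1) (n + 1) → M) :
    ∑ c, F c = ∑ c : LatticePath 0 b n, F c.consSnd := by
  refine (Function.Bijective.sum_comp ⟨LatticePath.consSnd_injective, fun c => ?_⟩ F).symm
  refine c.exists_consSnd (by omega) fun h0 => ?_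
  have := c.rank (by omega) 1
  simp [h0] at this

theorem LatticePath.sum_succ_succ {a b n : ℕ} (h : a + 1 + (b + 1) = n + 1)
    (F : LatticePath (a + 1) (b + 1) (n + 1) → M) :
    ∑ c, F c = ∑ c : LatticePath a (b + 1) n, F c.consFst +
      ∑ c : LatticePath (a + 1) b n, F c.consSnd := by
  rw [← Fintype.sum_sumElim]
  refine ((Function.Bijective.sum_comp (e := Sum.elim LatticePath.consFst LatticePath.consSnd)
    ⟨?_, fun c => ?_⟩ F).symm.trans ?_)
  · refine Function.Injective.sumElim LatticePath.consFst_injective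
      LatticePath.consSnd_injective fun c d hcd => ?_
    have h1 := congrArg (fun x => ((x.1 (Fin.succ 0)).1 : ℕ)) hcd
    have h2 := d.apply_zero (by omega)
    simp only [LatticePath.consFst, LatticePath.consSnd, Fin.cons_succ, Fin.val_succ, h2] at h1
    simp at h1
  · by_cases h0 : (c.1 1).1 = 0
    · obtain ⟨d, hd⟩ := c.exists_consSnd (by omega) fun h1 => by
        have := c.rank h 1
        simp [h0, h1] at this
      exact ⟨Sum.inr d, hd⟩
    · obtain ⟨d, hd⟩ := c.exists_consFst (by omega) h0
      exact ⟨Sum.inl d, hd⟩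
  · refine Fintype.sum_congr _ _ fun x => ?_
    cases x <;> rfl

end LatticePaths

/-! ### The recursive shuffle product as a signed sum over lattice paths. -/

section ShuffleFormula

variable {k : Type*} [Field k] {V W : Type*}

theorem single_consFst {a b n : ℕ} (v : Fin (a + 2) → V) (w : Fin (b + 1) → W)
    (c : LatticePath a b n) :
    Finsupp.single (List.ofFn fun j => (v (c.consFst.1 j).1, w (c.consFst.1 j).2))
        ((-1 : k) ^ c.consFst.area) =
      listCons (v 0, w 0) (Finsupp.single
        (List.ofFn fun j => (v (c.1 j).1.succ, w (c.1 j).2)) ((-1 : k) ^ c.area)) := by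
  rw [LatticePath.area_consFst, List.ofFn_succ, listCons_single]
  simp [LatticePath.consFst]

theorem single_consSnd {a b n : ℕ} (h : a + b = n) (v : Fin (a + 1) → V) (w : Fin (b + 2) → W)
    (c : LatticePath a b n) :
    Finsupp.single (List.ofFn fun j => (v (c.consSnd.1 j).1, w (c.consSnd.1 j).2))
        ((-1 : k) ^ c.consSnd.area) =
      (-1 : k) ^ a • listCons (v 0, w 0) (Finsupp.single
        (List.ofFn fun j => (v (c.1 j).1, w (c.1 j).2.succ)) ((-1 : k) ^ c.area)) := by
  rw [LatticePath.area_consSnd h, List.ofFn_succ, listCons_single, Finsupp.smul_single, pow_add,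
    smul_eq_mul, mul_comm]
  simp [LatticePath.consSnd]

/-- Both sides obey the same recursion on the first step; if one factor is a point, only one kind of
step is available. -/
theorem listShuffle_ofFn {a b n : ℕ} (h : a + b = n) (v : Fin (a + 1) → V) (w : Fin (b + 1) → W) :
    listShuffle k (List.ofFn v) (List.ofFn w) =
      ∑ c : LatticePath a b n, Finsupp.single
        (List.ofFn fun j => (v (c.1 j).1, w (c.1 j).2)) ((-1 : k) ^ c.area) := by
  induction n generalizing a b with
  | zero =>
    obtain rfl : a = 0 := by omega
    obtain rfl : b = 0 := by omega
    have : Subsingleton (Fin (0 + 1)) := inferInstanceAs (Subsingleton (Fin 1))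
    let u : Unique (LatticePath 0 0 0) :=
      { default := ⟨fun _ => (0, 0), Subsingleton.strictMono _⟩
        uniq := fun c => Subtype.ext (funext fun j => Subsingleton.elim _ _) }
    rw [Fintype.sum_unique]
    have h1 : ((default : LatticePath 0 0 0)).area = 0 := by simp [LatticePath.area]
    have h2 : ∀ j, (default : LatticePath 0 0 0).1 j = (0, 0) := fun j => rfl
    simp [listShuffle_cons, h1, h2]
  | succ n ih =>
    rw [List.ofFn_succ (f := v), List.ofFn_succ (f := w), listShuffle_cons,
      if_neg (by simp; omega), zero_add, List.length_ofFn]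
    cases a with
    | zero =>
      cases b with
      | zero => simp at h
      | succ b =>
        rw [LatticePath.sum_zero_succ (by omega), ← List.ofFn_succ (f := v), ih (by omega)]
        simp only [List.ofFn_zero, listShuffle_nil_left, zero_add, map_smul, map_sum,
          single_consSnd (by omega : 0 + b = n), ← Finset.smul_sum]
    | succ a =>
      cases b with
      | zero =>
        rw [LatticePath.sum_succ_zero (by omega), ← List.ofFn_succ (f := w), ih (by omega)]
        simp only [List.ofFn_zero, listShuffle_nil_right, add_zero, smul_zero, map_sum,
          single_consFst]
      | succ b =>
        rw [LatticePath.sum_succ_succ h, ← List.ofFn_succ (f := w), ← List.ofFn_succ (f := v),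
          ih (by omega), ih (by omega)]
        simp only [map_add, map_smul, map_sum, single_consFst,
          single_consSnd (by omega : a + 1 + b = n), ← Finset.smul_sum]

end ShuffleFormula

/-! ### Geodesic simplices and lists of vertices that span them. -/

section Geodesics

theorem SmoothSimplex.ext_toFun {n : ℕ} {σ σ' : SmoothSimplex n} (h : ∀ t, σ.toFun t = σ'.toFun t) :
    σ = σ' := by
  cases σ
  cases σ'
  congr
  exact funext h

theorem radialProj_congr {x y : ℕ →₀ ℂ} (h : x = y) (hx : x ≠ 0) (hy : y ≠ 0) :
    radialProj x hx = radialProj y hy := by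
  subst h
  rfl

theorem geodesic_congr {n : ℕ} {v v' : Fin (n + 1) → SInf} (h : v = v') (hv) (hv') :
    geodesic v hv = geodesic v' hv' := by
  subst h
  rfl

theorem comb_map {m n : ℕ} (v : Fin (n + 1) → SInf) (f : Fin (m + 1) → Fin (n + 1))
    (t : stdSimplex ℝ (Fin (m + 1))) :
    comb v (stdSimplex.map f t).1 = comb (v ∘ f) t.1 := by
  classical
  have h : ∀ l, (stdSimplex.map f t).1 l = ∑ i with f i = l, t.1 i := by
    intro l
    exact FunOnFinite.linearMap_apply_apply ℝ ℝ f t.1 l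
  simp only [comb, h, Complex.ofReal_sum, Finset.sum_smul, Function.comp]
  rw [← Finset.sum_fiberwise (s := Finset.univ) (g := f) (f := fun i => (t.1 i : ℂ) • (v (f i)).1)]
  refine Finset.sum_congr rfl fun l _ => Finset.sum_congr rfl fun i hi => ?_
  rw [(Finset.mem_filter.1 hi).2]

/-- Radial projection is applied after the affine combination, so an affine change of simplex only
relabels the vertices. This covers both faces and the simplices of a shuffle product. -/
theorem geodesic_precomp {m n : ℕ} (v : Fin (n + 1) → SInf) (hv)
    (f : Fin (m + 1) → Fin (n + 1)) (hvf) :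
    (geodesic v hv).precomp f = geodesic (v ∘ f) hvf :=
  SmoothSimplex.ext_toFun fun t => radialProj_congr (comb_map v f t)
    (hv _ (stdSimplex.map f t).2) (hvf _ t.2)

theorem comb_rot (p : ℕ) {n : ℕ} (v : Fin (n + 1) → SInf) (t : Fin (n + 1) → ℝ) :
    comb (rot p ∘ v) t = (zeta p : ℂ) • comb v t := by
  ext j
  simp only [comb, Finsupp.finsetSum_apply, Finsupp.smul_apply, Finset.smul_sum, rot,
    Function.comp, Finsupp.mapRange_apply, smul_eq_mul]
  refine Finset.sum_congr rfl fun l _ => ?_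
  ring

theorem sqNorm_zeta_smul (p : ℕ) (x : ℕ →₀ ℂ) : sqNorm ((zeta p : ℂ) • x) = sqNorm x := by
  rw [sqNorm, sqNorm, Finsupp.sum_smul_index' (by simp)]
  simp only [smul_eq_mul, norm_mul, Circle.norm_coe, one_mul]

theorem geodesic_rot (p : ℕ) {n : ℕ} (v : Fin (n + 1) → SInf) (hv) (hvr) :
    (geodesic v hv).rot p = geodesic (rot p ∘ v) hvr := by
  refine SmoothSimplex.ext_toFun fun t => Subtype.ext ?_
  ext j
  simp only [SmoothSimplex.rot, geodesic, rot, radialProj, comb_rot, sqNorm_zeta_smul,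
    Finsupp.mapRange_apply, Finsupp.smul_apply, smul_eq_mul]
  ring

/-- A list of points of the sphere is admissible if its members are endpoints of chosen arcs, one
in each coordinate circle before the `N`-th one. -/
def Admissible (p N : ℕ) (l : List SInf) : Prop :=
  ∃ m : ℕ → ℕ, ∀ v ∈ l, ∃ j < N, v = vertex p j (m j) ∨ v = vertex p j (m j + 1)

theorem Admissible.mono {p N N' : ℕ} {l l' : List SInf} (h : Admissible p N l) (hN : N ≤ N')
    (hl : l' ⊆ l) : Admissible p N' l' := by
  obtain ⟨m, hm⟩ := h
  refine ⟨m, fun v hv => ?_⟩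
  obtain ⟨j, hj, h⟩ := hm v (hl hv)
  exact ⟨j, hj.trans_le hN, h⟩

theorem Admissible.map_rot {p N : ℕ} {l : List SInf} (h : Admissible p N l) :
    Admissible p N (l.map (rot p)) := by
  obtain ⟨m, hm⟩ := h
  refine ⟨fun j => m j + 1, fun v hv => ?_⟩
  obtain ⟨w, hw, rfl⟩ := List.mem_map.1 hv
  obtain ⟨j, hj, h⟩ := hm w hw
  refine ⟨j, hj, ?_⟩
  rw [← rot_vertex, ← rot_vertex]
  exact h.imp (congrArg _) (congrArg _)

theorem Admissible.cons {p N : ℕ} {l : List SInf} (h : Admissible p N l) :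
    Admissible p (N + 1) (vertex p N 0 :: l) := by
  obtain ⟨m, hm⟩ := h
  -- The `N`-th circle is unused so far, so its arc can be chosen freely to start at the new vertex.
  refine ⟨Function.update m N 0, fun v hv => ?_⟩
  rcases List.mem_cons.1 hv with rfl | hv
  · exact ⟨N, by omega, Or.inl (by simp)⟩
  · obtain ⟨j, hj, h⟩ := hm v hv
    exact ⟨j, by omega, by rwa [Function.update_of_ne hj.ne]⟩

theorem Admissible.comb_ne_zero {p N : ℕ} (hp : 2 < p) {n : ℕ} {v : Fin (n + 1) → SInf}
    (hv : Admissible p N (List.ofFn v)) (t : Fin (n + 1) → ℝ)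
    (ht : t ∈ stdSimplex ℝ (Fin (n + 1))) : comb v t ≠ 0 := by
  classical
  obtain ⟨e, he⟩ := hv
  -- Multiplication by `w j` centres the chosen arc of the `j`-th circle at `1`, so that both of its
  -- endpoints get real part `cos (π / p)`.
  let w : ℕ → ℂ := fun j => ((Circle.exp (-(Real.pi / p)) * (zeta p ^ e j)⁻¹ : Circle) : ℂ)
  let L : (ℕ →₀ ℂ) →ₗ[ℝ] ℝ := Finsupp.lsum ℝ fun j =>
    Complex.reLm.comp (LinearMap.mulLeft ℝ (w j))
  have hpp : (2 : ℝ) < p := by exact_mod_cast hp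
  have hcos : 0 < Real.cos (Real.pi / p) := by
    apply Real.cos_pos_of_mem_Ioo
    constructor
    · have : 0 < Real.pi / p := by positivity
      linarith [Real.pi_pos]
    · exact div_lt_div_of_pos_left Real.pi_pos two_pos hpp
  have hL' : ∀ j r, L (vertex p j (e j + r)).1 =
      ((Circle.exp (-(Real.pi / p)) * zeta p ^ r : Circle) : ℂ).re := by
    intro j r
    have h1 : L (vertex p j (e j + r)).1 = (w j * ((zeta p ^ (e j + r) : Circle) : ℂ)).re := by
      simp only [vertex, L]
      rw [Finsupp.lsum_single]
      simp
    rw [h1, pow_add, ← Circle.coe_mul, mul_assoc, inv_mul_cancel_left]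
  have hL : ∀ l, L (v l).1 = Real.cos (Real.pi / p) := by
    intro l
    obtain ⟨j, _, h | h⟩ := he (v l) (List.mem_ofFn.2 ⟨l, rfl⟩)
    · rw [h, ← add_zero (e j), hL', pow_zero, mul_one, Circle.coe_exp,
        Complex.exp_ofReal_mul_I_re, Real.cos_neg]
    · rw [h, hL', pow_one, zeta, ← Circle.exp_add, Circle.coe_exp, Complex.exp_ofReal_mul_I_re]
      congr 1
      ring
  intro h0
  have h3 : L (comb v t) = Real.cos (Real.pi / p) := by
    have h4 : comb v t = ∑ l, t l • (v l).1 := by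
      simp only [comb]
      refine Finset.sum_congr rfl fun l _ => ?_
      ext j
      simp
    rw [h4, map_sum]
    simp only [map_smul, hL, smul_eq_mul]
    rw [← Finset.sum_mul, ht.2, one_mul]
  rw [h0, map_zero] at h3
  exact hcos.ne h3

open Classical in
/-- The geodesic simplex with a given list of vertices, with an arbitrary value if the list does
not define one. -/
def listSimplex (p : ℕ) (hp : 2 < p) (n : ℕ) (l : List SInf) : SmoothSimplex n :=
  if h : ∀ t ∈ stdSimplex ℝ (Fin (n + 1)),
      comb (fun i : Fin (n + 1) => l.getD i (vertex p 0 0)) t ≠ 0 then geodesic _ h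
  else geodesic _ (cellVertex_comb_ne_zero p hp n fun _ => ⟨0, by omega⟩)

theorem listSimplex_ofFn (p : ℕ) (hp : 2 < p) {n : ℕ} (v : Fin (n + 1) → SInf) (hv) :
    listSimplex p hp n (List.ofFn v) = geodesic v hv := by
  have h : (fun i : Fin (n + 1) => (List.ofFn v).getD i (vertex p 0 0)) = v := by
    funext i
    rw [List.getD_eq_getElem _ _ (by simp; omega), List.getElem_ofFn]
  rw [listSimplex, dif_pos (by rwa [h])]
  exact geodesic_congr h _ _

theorem listSimplex_precomp {p N : ℕ} (hp : 2 < p) {m n : ℕ} (v : Fin (n + 1) → SInf)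
    (hv : Admissible p N (List.ofFn v)) (f : Fin (m + 1) → Fin (n + 1)) :
    (listSimplex p hp n (List.ofFn v)).precomp f = listSimplex p hp m (List.ofFn (v ∘ f)) := by
  have hvf : Admissible p N (List.ofFn (v ∘ f)) := hv.mono le_rfl fun x hx => by
    obtain ⟨i, rfl⟩ := List.mem_ofFn.1 hx
    exact List.mem_ofFn.2 ⟨f i, rfl⟩
  rw [listSimplex_ofFn p hp v (hv.comb_ne_zero hp), listSimplex_ofFn p hp _ (hvf.comb_ne_zero hp),
    geodesic_precomp]

theorem listSimplex_rot {p N : ℕ} (hp : 2 < p) {n : ℕ} (v : Fin (n + 1) → SInf)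
    (hv : Admissible p N (List.ofFn v)) :
    (listSimplex p hp n (List.ofFn v)).rot p = listSimplex p hp n (List.ofFn (rot p ∘ v)) := by
  have hvr : Admissible p N (List.ofFn (rot p ∘ v)) := by
    rw [← List.map_ofFn]
    exact hv.map_rot
  rw [listSimplex_ofFn p hp v (hv.comb_ne_zero hp), listSimplex_ofFn p hp _ (hvr.comb_ne_zero hp),
    geodesic_rot]

end Geodesics

/-! ### From chains of vertex lists to smooth singular chains. -/

section Realization

variable {k : Type*} [Field k]

theorem exists_eq_ofFn {α : Type*} {n : ℕ} (l : List α) (h : l.length = n) :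
    ∃ u : Fin n → α, l = List.ofFn u := by
  subst h
  exact ⟨l.get, (List.ofFn_get l).symm⟩

/-- `listSimplex` takes a junk value on lists that span no geodesic simplex, so compatibilities are
compared only on chains supported on admissible lists. -/
theorem eq_of_mem_supported {α M : Type*} [AddCommGroup M] [Module k M] {s : Set α}
    (f g : (α →₀ k) →ₗ[k] M) (h : ∀ a ∈ s, f (Finsupp.single a 1) = g (Finsupp.single a 1))
    {x : α →₀ k} (hx : x ∈ Finsupp.supported k k s) : f x = g x := by
  rw [Finsupp.supported_eq_span_single] at hx
  refine LinearMap.eqOn_span (s := (fun i => Finsupp.single i (1 : k)) '' s) ?_ hx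
  rintro _ ⟨a, ha, rfl⟩
  exact h a ha

theorem listFaces_ofFn {V : Type*} {n : ℕ} (v : Fin (n + 1) → V) :
    listFaces k (List.ofFn v) =
      ∑ i : Fin (n + 1), (-1 : k) ^ (i : ℕ) • Finsupp.single (List.ofFn (v ∘ i.succAbove)) 1 := by
  induction n with
  | zero => simp [listFaces]
  | succ n ih =>
    rw [List.ofFn_succ, listFaces_cons, ih]
    conv_rhs => rw [Fin.sum_univ_succ]
    rw [map_sum, sub_eq_add_neg,
      ← Finset.sum_neg_distrib]
    congr 1
    · simp [Function.comp_def]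
    · refine Finset.sum_congr rfl fun i _ => ?_
      rw [map_smul, listCons_single, Fin.val_succ, pow_succ, mul_neg_one, neg_smul,
        List.ofFn_succ (f := v ∘ i.succ.succAbove)]
      simp [Function.comp_def]

/-- The chains of admissible lists of dimension `n`. -/
def admChain (k : Type*) [Field k] (p N n : ℕ) : Submodule k (List SInf →₀ k) :=
  Finsupp.supported k k {l | l.length = n + 1 ∧ Admissible p N l}

/-- The chains of lists of pairs of dimension `n` both of whose components are admissible. -/
def admPairChain (k : Type*) [Field k] (p N n : ℕ) : Submodule k (List (SInf × SInf) →₀ k) :=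
  Finsupp.supported k k {l | l.length = n + 1 ∧ Admissible p N (l.map Prod.fst) ∧
    Admissible p N (l.map Prod.snd)}

/-- The realization of chains of vertex lists by smooth singular chains. -/
def realize (k : Type*) [Field k] (p : ℕ) (hp : 2 < p) (n : ℕ) : (List SInf →₀ k) →ₗ[k] Chain k n :=
  Finsupp.lmapDomain k k (listSimplex p hp n)

/-- The realization of chains of lists of pairs of vertices by smooth singular chains. -/
def realizePair (k : Type*) [Field k] (p : ℕ) (hp : 2 < p) (n : ℕ) :
    (List (SInf × SInf) →₀ k) →ₗ[k] ProdChain k n :=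
  Finsupp.lmapDomain k k fun l =>
    (listSimplex p hp n (l.map Prod.fst), listSimplex p hp n (l.map Prod.snd))

theorem realize_single (p : ℕ) (hp : 2 < p) (n : ℕ) (l : List SInf) (r : k) :
    realize k p hp n (Finsupp.single l r) = Finsupp.single (listSimplex p hp n l) r := by
  simp [realize, Finsupp.mapDomain_single]

theorem realizePair_single (p : ℕ) (hp : 2 < p) (n : ℕ) (l : List (SInf × SInf)) (r : k) :
    realizePair k p hp n (Finsupp.single l r) = Finsupp.single
      (listSimplex p hp n (l.map Prod.fst), listSimplex p hp n (l.map Prod.snd)) r := by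
  simp [realizePair, Finsupp.mapDomain_single]

theorem realizePair_listBoundary {p N n : ℕ} (hp : 2 < p) {x : List (SInf × SInf) →₀ k}
    (hx : x ∈ admPairChain k p N (n + 1)) :
    realizePair k p hp n (listBoundary x) = boundary (realizePair k p hp (n + 1) x) := by
  refine eq_of_mem_supported (realizePair k p hp n ∘ₗ listBoundary)
    (boundary ∘ₗ realizePair k p hp (n + 1)) ?_ hx
  rintro l ⟨hl, h1, h2⟩
  obtain ⟨u, rfl⟩ := exists_eq_ofFn l hl
  rw [List.map_ofFn] at h1 h2
  simp only [LinearMap.comp_apply, listBoundary_single_one, listFaces_ofFn, map_sum, map_smul,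
    realizePair_single, boundary, LinearMap.sum_apply, LinearMap.smul_apply,
    Finsupp.lmapDomain_apply, Finsupp.mapDomain_single, List.map_ofFn]
  refine Finset.sum_congr rfl fun i _ => ?_
  rw [listSimplex_precomp hp _ h1, listSimplex_precomp hp _ h2]
  rfl

theorem realize_listEnd_rot {p N n : ℕ} (hp : 2 < p) {x : List SInf →₀ k}
    (hx : x ∈ admChain k p N n) :
    realize k p hp n (listEnd k (rot p) x) = tau p (realize k p hp n x) := by
  refine eq_of_mem_supported (realize k p hp n ∘ₗ listEnd k (rot p))
    (tau p ∘ₗ realize k p hp n) ?_ hx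
  rintro l ⟨hl, h⟩
  obtain ⟨u, rfl⟩ := exists_eq_ofFn l hl
  simp only [LinearMap.comp_apply, listEnd, listMap_single, realize_single, tau,
    Finsupp.lmapDomain_apply, Finsupp.mapDomain_single, List.map_ofFn]
  rw [listSimplex_rot hp _ h]

theorem realizePair_listRotRot {p N n : ℕ} (hp : 2 < p) {x : List (SInf × SInf) →₀ k}
    (hx : x ∈ admPairChain k p N n) :
    realizePair k p hp n (listRotRot k p x) = tauTau p (realizePair k p hp n x) := by
  refine eq_of_mem_supported (realizePair k p hp n ∘ₗ listRotRot k p)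
    (tauTau p ∘ₗ realizePair k p hp n) ?_ hx
  rintro l ⟨hl, h1, h2⟩
  obtain ⟨u, rfl⟩ := exists_eq_ofFn l hl
  rw [List.map_ofFn] at h1 h2
  simp only [LinearMap.comp_apply, listRotRot, listEnd, listMap_single, realizePair_single, tauTau,
    Finsupp.lmapDomain_apply, Finsupp.mapDomain_single, List.map_ofFn, Prod.map_apply]
  rw [listSimplex_rot hp _ h1, listSimplex_rot hp _ h2]
  rfl

theorem realizePair_diag (p : ℕ) (hp : 2 < p) (n : ℕ) (x : List SInf →₀ k) :
    realizePair k p hp n (listMap (fun v => (v, v)) x) = diag (realize k p hp n x) := by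
  refine eq_of_mem_supported (s := Set.univ) (realizePair k p hp n ∘ₗ listMap fun v => (v, v))
    (diag ∘ₗ realize k p hp n) ?_ (by simp)
  intro l _
  simp [realizePair_single, realize_single, diag, Finsupp.mapDomain_single, Function.comp_def]

/-- The cross product of chains as a bilinear map. -/
def crossBilin (k : Type*) [Field k] (a b n : ℕ) : Chain k a →ₗ[k] Chain k b →ₗ[k] ProdChain k n :=
  Finsupp.linearCombination k fun σ => Finsupp.linearCombination k fun σ' =>
    ∑ c : LatticePath a b n, Finsupp.single
      (σ.precomp (fun j => (c.1 j).1), σ'.precomp (fun j => (c.1 j).2)) ((-1 : k) ^ c.area)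

theorem cross_eq_crossBilin {a b n : ℕ} (h : a + b = n) (x : Chain k a) (y : Chain k b) :
    cross h x y = crossBilin k a b n x y := by
  rw [cross, crossBilin, Finsupp.linearCombination_apply, Finsupp.sum, Finsupp.sum,
    LinearMap.sum_apply]
  refine Finset.sum_congr rfl fun σ _ => ?_
  rw [LinearMap.smul_apply, Finsupp.linearCombination_apply, Finsupp.sum, Finsupp.sum,
    Finset.smul_sum]
  refine Finset.sum_congr rfl fun σ' _ => ?_
  rw [Finset.smul_sum, Finset.smul_sum]
  refine Finset.sum_congr rfl fun c _ => ?_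
  rw [Finsupp.smul_single, Finsupp.smul_single, smul_eq_mul, smul_eq_mul]
  congr 1
  ring

theorem realizePair_listCross {p N M a b n : ℕ} (hp : 2 < p) (h : a + b = n)
    {x y : List SInf →₀ k} (hx : x ∈ admChain k p N a) (hy : y ∈ admChain k p M b) :
    realizePair k p hp n (listCross x y) = cross h (realize k p hp a x) (realize k p hp b y) := by
  rw [cross_eq_crossBilin]
  -- Bilinearity reduces the claim to single lists, one argument at a time.
  refine eq_of_mem_supported (realizePair k p hp n ∘ₗ listCross.flip y)
    ((crossBilin k a b n).flip (realize k p hp b y) ∘ₗ realize k p hp a) ?_ hx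
  rintro l ⟨hl, h1⟩
  refine eq_of_mem_supported (realizePair k p hp n ∘ₗ listCross (Finsupp.single l 1))
    ((crossBilin k a b n) (realize k p hp a (Finsupp.single l 1)) ∘ₗ realize k p hp b) ?_ hy
  rintro m ⟨hm, h2⟩
  obtain ⟨u, rfl⟩ := exists_eq_ofFn l hl
  obtain ⟨v, rfl⟩ := exists_eq_ofFn m hm
  simp only [LinearMap.comp_apply, listCross_single_one, listShuffle_ofFn h, map_sum,
    realizePair_single, realize_single, crossBilin, Finsupp.linearCombination_single, one_smul,
    List.map_ofFn, listSimplex_precomp hp _ h1, listSimplex_precomp hp _ h2]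
  rfl

theorem listCross_mem_admPairChain {p N M a b n : ℕ} (h : a + b = n) (hN : N ≤ n + 1)
    (hM : M ≤ n + 1)
    {x y : List SInf →₀ k} (hx : x ∈ admChain k p N a) (hy : y ∈ admChain k p M b) :
    listCross x y ∈ admPairChain k p (n + 1) n := by
  rw [admChain, Finsupp.supported_eq_span_single] at hx hy
  induction hx using Submodule.span_induction with
  | mem x hx =>
    obtain ⟨l, ⟨hl, h1⟩, rfl⟩ := hx
    induction hy using Submodule.span_induction with
    | mem x hx =>
      obtain ⟨m, ⟨hm, h2⟩, rfl⟩ := hx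
      obtain ⟨u, rfl⟩ := exists_eq_ofFn l hl
      obtain ⟨v, rfl⟩ := exists_eq_ofFn m hm
      rw [listCross_single_one, listShuffle_ofFn h]
      refine Submodule.sum_mem _ fun c _ => Finsupp.single_mem_supported _ _ ⟨by simp, ?_, ?_⟩
      · refine h1.mono hN fun w hw => ?_
        rw [List.map_ofFn] at hw
        obtain ⟨i, rfl⟩ := List.mem_ofFn.1 hw
        exact List.mem_ofFn.2 ⟨_, rfl⟩
      · refine h2.mono hM fun w hw => ?_
        rw [List.map_ofFn] at hw
        obtain ⟨i, rfl⟩ := List.mem_ofFn.1 hw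
        exact List.mem_ofFn.2 ⟨_, rfl⟩
    | zero => rw [map_zero]; exact zero_mem _
    | add x y _ _ hx hy => rw [map_add]; exact add_mem hx hy
    | smul r x _ hx => rw [map_smul]; exact Submodule.smul_mem _ r hx
  | zero => rw [map_zero]; exact zero_mem _
  | add x y _ _ hx hy => rw [map_add]; exact add_mem hx hy
  | smul r x _ hx => rw [map_smul]; exact Submodule.smul_mem _ r hx

theorem listEnd_rot_mem {p N n : ℕ} {x : List SInf →₀ k} (hx : x ∈ admChain k p N n) :
    listEnd k (rot p) x ∈ admChain k p N n := by
  refine lmapDomain_mem_supported (t := {l : List _ | l.length = n + 1 ∧ Admissible p N l}) _ ?_ hx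
  rintro l ⟨hl, h⟩
  exact ⟨by simpa using hl, h.map_rot⟩

theorem listRotRot_mem {p N n : ℕ} {x : List (SInf × SInf) →₀ k}
    (hx : x ∈ admPairChain k p N n) : listRotRot k p x ∈ admPairChain k p N n := by
  refine lmapDomain_mem_supported (t := {l : List (SInf × SInf) | l.length = n + 1 ∧
    Admissible p N (l.map Prod.fst) ∧
    Admissible p N (l.map Prod.snd)}) _ ?_ hx
  rintro l ⟨hl, h1, h2⟩
  refine ⟨by simpa using hl, ?_, ?_⟩
  · have := h1.map_rot
    rw [List.map_map] at this ⊢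
    exact this
  · have := h2.map_rot
    rw [List.map_map] at this ⊢
    exact this

end Realization

/-! ### Realization of the cells, the diagonal terms and the filling chains. -/

section Cells

variable {k : Type*} [Field k]

/-- The vertices of a simplex of a cell of the sphere of sequences that are supported in
`[s, ∞)`. -/
def shiftedCellVertex (p s q : ℕ) (m : Fin q → Fin p) (l : ℕ) : SInf :=
  vertex p (s + l / 2) ((if h : l / 2 < q then (m ⟨l / 2, h⟩ : ℕ) else 0) + l % 2)

theorem shiftedCellVertex_add_two (p s q : ℕ) (m₀ : Fin p) (m : Fin q → Fin p) (l : ℕ) :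
    shiftedCellVertex p s (q + 1) (Fin.cons m₀ m) (l + 1 + 1) =
      shiftedCellVertex p (s + 1) q m l := by
  have h1 : (l + 1 + 1) / 2 = l / 2 + 1 := by omega
  have h2 : (l + 1 + 1) % 2 = l % 2 := by omega
  simp only [shiftedCellVertex, h1, h2]
  congr 1
  · ring
  · congr 1
    by_cases h : l / 2 < q
    · rw [dif_pos (by omega), dif_pos h]
      exact congrArg Fin.val (Fin.cons_succ (α := fun _ => Fin p) m₀ m ⟨l / 2, h⟩)
    · rw [dif_neg (by omega), dif_neg h]

/-- The recursion peels off the first circle, so the choice of its arc is the head of the index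
tuple; the shift `s` keeps track of the circles already removed. -/
theorem listCell_eq_sum (p : ℕ) (i s q : ℕ) (hq : q = i / 2) :
    listCell k p i s = ∑ m : Fin q → Fin p,
      Finsupp.single (List.ofFn fun l : Fin (i + 1) => shiftedCellVertex p s q m l) 1 := by
  induction i using Nat.twoStepInduction generalizing s q with
  | zero =>
    obtain rfl : q = 0 := by simpa using hq
    simp [listCell, shiftedCellVertex]
  | one =>
    obtain rfl : q = 0 := by simpa using hq
    simp [listCell, shiftedCellVertex]
  | more i ih _ =>
    obtain ⟨q, rfl⟩ : ∃ r, q = r + 1 := ⟨i / 2, by omega⟩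
    rw [listCell, ih (s + 1) q (by omega), circleJoin_apply, Finset.sum_range,
      ← (Fin.consEquiv fun _ => Fin p).sum_comp, Fintype.sum_prod_type]
    refine Finset.sum_congr rfl fun m₀ _ => ?_
    rw [map_sum, map_sum]
    refine Finset.sum_congr rfl fun m _ => ?_
    rw [listCons_single, listCons_single]
    conv_rhs => rw [List.ofFn_succ, List.ofFn_succ]
    have hc : (Fin.consEquiv fun _ => Fin p) (m₀, m) = Fin.cons m₀ m := rfl
    have h0 : shiftedCellVertex p s (q + 1) (Fin.cons m₀ m) 0 = vertex p s m₀ := by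
      simp [shiftedCellVertex]
    have h1 : shiftedCellVertex p s (q + 1) (Fin.cons m₀ m) 1 = vertex p s (m₀ + 1) := by
      simp [shiftedCellVertex]
    simp only [hc, Fin.val_succ, Fin.val_zero, zero_add, shiftedCellVertex_add_two, h0, h1]

theorem listCell_eq_sum_cellVertex (p i : ℕ) :
    listCell k p i 0 =
      ∑ m : Fin (i / 2) → Fin p, Finsupp.single (List.ofFn (cellVertex p i m)) 1 := by
  rw [listCell_eq_sum p i 0 _ rfl]
  simp only [shiftedCellVertex, zero_add]
  rfl

theorem admissible_cellVertex (p i : ℕ) (m : Fin (i / 2) → Fin p) :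
    Admissible p (i + 1) (List.ofFn (cellVertex p i m)) := by
  refine ⟨fun j => if h : j < i / 2 then (m ⟨j, h⟩ : ℕ) else 0, fun v hv => ?_⟩
  obtain ⟨l, rfl⟩ := List.mem_ofFn.1 hv
  refine ⟨l / 2, by omega, ?_⟩
  rcases Nat.mod_two_eq_zero_or_one l with h | h
  · exact Or.inl (by rw [cellVertex, h, add_zero])
  · exact Or.inr (by rw [cellVertex, h])

theorem listCell_mem_admChain (p i : ℕ) : listCell k p i 0 ∈ admChain k p (i + 1) i := by
  rw [listCell_eq_sum_cellVertex]
  exact Submodule.sum_mem _ fun m _ =>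
    Finsupp.single_mem_supported _ _ ⟨by simp, admissible_cellVertex p i m⟩

theorem realize_listCell (p : ℕ) (hp : 2 < p) (i : ℕ) :
    realize k p hp i (listCell k p i 0) = cell k p hp i := by
  rw [listCell_eq_sum_cellVertex, map_sum, cell]
  refine Finset.sum_congr rfl fun m _ => ?_
  rw [realize_single, listSimplex_ofFn]

theorem listEnd_rot_pow_mem {p N n : ℕ} (j : ℕ) {x : List SInf →₀ k} (hx : x ∈ admChain k p N n) :
    (listEnd k (rot p) ^ j) x ∈ admChain k p N n := by
  induction j with
  | zero => exact hx
  | succ j ih => rw [pow_succ']; exact listEnd_rot_mem ih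

theorem realize_listEnd_rot_pow {p N n : ℕ} (hp : 2 < p) (j : ℕ) {x : List SInf →₀ k}
    (hx : x ∈ admChain k p N n) :
    realize k p hp n ((listEnd k (rot p) ^ j) x) = (tau p ^ j) (realize k p hp n x) := by
  induction j with
  | zero => rfl
  | succ j ih =>
    rw [pow_succ', pow_succ', Module.End.mul_apply, Module.End.mul_apply,
      realize_listEnd_rot hp (listEnd_rot_pow_mem j hx), ih]

theorem listRotRot_pow_mem {p N n : ℕ} (j : ℕ) {x : List (SInf × SInf) →₀ k}
    (hx : x ∈ admPairChain k p N n) : (listRotRot k p ^ j) x ∈ admPairChain k p N n := by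
  induction j with
  | zero => exact hx
  | succ j ih => rw [pow_succ']; exact listRotRot_mem ih

theorem realizePair_listRotRot_pow {p N n : ℕ} (hp : 2 < p) (j : ℕ) {x : List (SInf × SInf) →₀ k}
    (hx : x ∈ admPairChain k p N n) :
    realizePair k p hp n ((listRotRot k p ^ j) x) = (tauTau p ^ j) (realizePair k p hp n x) := by
  induction j with
  | zero => rfl
  | succ j ih =>
    rw [pow_succ', pow_succ', Module.End.mul_apply, Module.End.mul_apply,
      realizePair_listRotRot hp (listRotRot_pow_mem j hx), ih]

theorem cyclicOp_listRotRot_mem {p N n : ℕ} (i : ℕ) {x : List (SInf × SInf) →₀ k}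
    (hx : x ∈ admPairChain k p N n) :
    cyclicOp p i (listRotRot k p) x ∈ admPairChain k p N n := by
  by_cases hi : Even i
  · rw [cyclicOp_even hi]
    exact sub_mem (listRotRot_mem hx) hx
  · rw [cyclicOp_odd hi, LinearMap.sum_apply]
    exact Submodule.sum_mem _ fun j _ => listRotRot_pow_mem j hx

theorem realizePair_cyclicOp {p N n : ℕ} (hp : 2 < p) (i : ℕ) {x : List (SInf × SInf) →₀ k}
    (hx : x ∈ admPairChain k p N n) :
    realizePair k p hp n (cyclicOp p i (listRotRot k p) x) =
      cyclicOp p i (tauTau p) (realizePair k p hp n x) := by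
  by_cases hi : Even i
  · rw [cyclicOp_even hi, cyclicOp_even hi]
    simp [realizePair_listRotRot hp hx]
  · rw [cyclicOp_odd hi, cyclicOp_odd hi, LinearMap.sum_apply, LinearMap.sum_apply, map_sum]
    exact Finset.sum_congr rfl fun j _ => realizePair_listRotRot_pow hp j hx

theorem listDiagTerm_listCell_mem (p : ℕ) {a b n : ℕ} (h : a + b = n) :
    listDiagTerm k p a b (listCell k p a 0) (listCell k p b 0) ∈ admPairChain k p (n + 1) n := by
  have ha := listCell_mem_admChain (k := k) p a
  have hb := listCell_mem_admChain (k := k) p b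
  have ha' : a + 1 ≤ n + 1 := by omega
  have hb' : b + 1 ≤ n + 1 := by omega
  rw [listDiagTerm, diagApprox]
  split_ifs
  · exact listCross_mem_admPairChain h ha' hb' ha hb
  · exact Submodule.sum_mem _ fun j _ => Submodule.sum_mem _ fun l _ =>
      listCross_mem_admPairChain h ha' hb' (listEnd_rot_pow_mem _ ha) (listEnd_rot_pow_mem _ hb)
  · exact listCross_mem_admPairChain h ha' hb' ha hb
  · exact listCross_mem_admPairChain h ha' hb' ha (listEnd_rot_mem hb)

theorem listDefect_mem (p i : ℕ) : listDefect k p i ∈ admPairChain k p (i + 1) i := by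
  refine sub_mem ?_ (Submodule.sum_mem _ fun x hx =>
    listDiagTerm_listCell_mem p (Finset.HasAntidiagonal.mem_antidiagonal.1 hx))
  refine lmapDomain_mem_supported (t := {l : List (SInf × SInf) | l.length = i + 1 ∧
    Admissible p (i + 1) (l.map Prod.fst) ∧ Admissible p (i + 1) (l.map Prod.snd)}) _ ?_
    (listCell_mem_admChain p i)
  rintro l ⟨hl, h⟩
  refine ⟨by simpa using hl, ?_, ?_⟩ <;> simpa [Function.comp_def] using h

/-- The chains of dimension `i` use only the first `i + 1` circles, so the next circle is free for
the apex of the cone. -/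
theorem listHomotopy_mem (p i : ℕ) : listHomotopy k p i ∈ admPairChain k p (i + 1) i := by
  induction i with
  | zero => exact zero_mem _
  | succ i ih =>
    refine lmapDomain_mem_supported (t := {l : List (SInf × SInf) | l.length = i + 1 + 1 ∧
      Admissible p (i + 1 + 1) (l.map Prod.fst) ∧ Admissible p (i + 1 + 1) (l.map Prod.snd)}) _ ?_
      (sub_mem (listDefect_mem p i) (cyclicOp_listRotRot_mem (i + 1) ih))
    rintro l ⟨hl, h1, h2⟩
    exact ⟨by simpa using hl, h1.cons, h2.cons⟩

/-- The realization of the interpolating chains satisfies the expected formula. -/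
theorem boundary_realizePair_listHomotopy (p : ℕ) (hp : 2 < p) (i : ℕ) :
    boundary (realizePair k p hp (i + 1) (listHomotopy k p (i + 1))) =
      diag (cell k p hp i)
      - ∑ x : Finset.HasAntidiagonal.antidiagonal i, realizePair k p hp i
          (listDiagTerm k p x.1.1 x.1.2 (listCell k p x.1.1 0) (listCell k p x.1.2 0))
      - cyclicOp p (i + 1) (tauTau p) (realizePair k p hp i (listHomotopy k p i)) := by
  rw [← realizePair_listBoundary hp (listHomotopy_mem p (i + 1)),
    listBoundary_listHomotopy p i (by omega), map_sub,
    realizePair_cyclicOp hp _ (listHomotopy_mem p i), listDefect, map_sub, realizePair_diag,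
    realize_listCell, map_sum]
  congr 2
  exact (Finset.sum_coe_sort (Finset.HasAntidiagonal.antidiagonal i) fun x => realizePair k p hp i
    (listDiagTerm k p x.1 x.2 (listCell k p x.1 0) (listCell k p x.2 0))).symm

theorem realizePair_listCross_rot (p : ℕ) (hp : 2 < p) {a b n : ℕ} (h : a + b = n) (j l : ℕ) :
    realizePair k p hp n (listCross ((listEnd k (rot p) ^ j) (listCell k p a 0))
      ((listEnd k (rot p) ^ l) (listCell k p b 0))) =
      cross h ((tau p ^ j) (cell k p hp a)) ((tau p ^ l) (cell k p hp b)) := by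
  have ha := listCell_mem_admChain (k := k) p a
  have hb := listCell_mem_admChain (k := k) p b
  rw [realizePair_listCross hp h (listEnd_rot_pow_mem _ ha) (listEnd_rot_pow_mem _ hb),
    realize_listEnd_rot_pow hp _ ha, realize_listEnd_rot_pow hp _ hb, realize_listCell,
    realize_listCell]

/-- For odd `a` the approximation has `τ` on the second factor, which is split as `1 + (τ - 1)`. -/
theorem realizePair_listDiagTerm_odd (p : ℕ) (hp : 2 < p) {a b n : ℕ} (h : a + b = n)
    (hn : Odd n) :
    realizePair k p hp n (listDiagTerm k p a b (listCell k p a 0) (listCell k p b 0)) =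
      cross h (cell k p hp a) (cell k p hp b) +
        if Odd a then cross h (cell k p hp a) ((tau p - 1 : Module.End k (Chain k b))
          (cell k p hp b)) else 0 := by
  have h00 := realizePair_listCross_rot (k := k) p hp h 0 0
  have h01 := realizePair_listCross_rot (k := k) p hp h 0 1
  simp only [pow_zero, pow_one, Module.End.one_apply] at h00 h01
  have hab : ¬ Even (a + b) := by rw [h]; simpa using hn
  rw [listDiagTerm, diagApprox, if_neg hab]
  by_cases ha : Even a
  · rw [if_pos ha, if_neg (by simpa using ha), add_zero, h00]
  · rw [if_neg ha, if_pos (by simpa using ha), h01]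
    simp only [cross_eq_crossBilin, LinearMap.sub_apply, Module.End.one_apply, map_sub]
    abel

theorem realizePair_listDiagTerm_even (p : ℕ) (hp : 2 < p) {a b n : ℕ} (h : a + b = n)
    (hn : Even n) :
    realizePair k p hp n (listDiagTerm k p a b (listCell k p a 0) (listCell k p b 0)) =
      (if Even a ∧ Even b then cross h (cell k p hp a) (cell k p hp b) else 0) +
        if Odd a then ∑ j ∈ Finset.range p, ∑ l ∈ Finset.range j,
          cross h ((tau p ^ l : Module.End k (Chain k a)) (cell k p hp a))
            ((tau p ^ j : Module.End k (Chain k b)) (cell k p hp b)) else 0 := by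
  have h00 := realizePair_listCross_rot (k := k) p hp h 0 0
  simp only [pow_zero, Module.End.one_apply] at h00
  have hab : Even (a + b) := by rwa [h]
  rw [listDiagTerm, diagApprox, if_pos hab]
  by_cases ha : Even a
  · have hb : Even b := by grind
    rw [if_pos ha, if_pos ⟨ha, hb⟩, if_neg (by simpa using ha), add_zero, h00]
  · rw [if_neg ha, if_neg (by tauto), if_pos (by simpa using ha), zero_add]
    simp only [map_sum, realizePair_listCross_rot p hp h]

end Cells

end SphereChains

end

theorem lemma4p9 (p : ℕ) [Fact p.Prime] (hp : 2 < p) (k : Type*) [Field k] [CharP k p] :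
    ∃ C : (i : ℕ) → ProdChain k i, ∀ i : ℕ,
      (Odd i → boundary (C (i + 1)) =
        diag (cell k p hp i)
        - (∑ x : Finset.HasAntidiagonal.antidiagonal i,
            cross (Finset.HasAntidiagonal.mem_antidiagonal.1 x.2)
              (cell k p hp x.1.1) (cell k p hp x.1.2))
        - (∑ x : Finset.HasAntidiagonal.antidiagonal i,
            if Odd x.1.1 then
              cross (Finset.HasAntidiagonal.mem_antidiagonal.1 x.2)
                (cell k p hp x.1.1)
                ((tau p - 1 : Module.End k (Chain k x.1.2))
                  (cell k p hp x.1.2))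
            else 0)
        - (tauTau p - 1 : Module.End k (ProdChain k i)) (C i)) ∧
      (Even i → boundary (C (i + 1)) =
        diag (cell k p hp i)
        - (∑ x : Finset.HasAntidiagonal.antidiagonal i,
            if Even x.1.1 ∧ Even x.1.2 then
              cross (Finset.HasAntidiagonal.mem_antidiagonal.1 x.2)
                (cell k p hp x.1.1) (cell k p hp x.1.2)
            else 0)
        - (∑ x : Finset.HasAntidiagonal.antidiagonal i,
            if Odd x.1.1 then
              ∑ j ∈ Finset.range p, ∑ l ∈ Finset.range j,
                cross (Finset.HasAntidiagonal.mem_antidiagonal.1 x.2)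
                  ((tau p ^ l : Module.End k (Chain k x.1.1))
                    (cell k p hp x.1.1))
                  ((tau p ^ j : Module.End k (Chain k x.1.2))
                    (cell k p hp x.1.2))
            else 0)
        - (∑ j ∈ Finset.range p,
            (tauTau p ^ j : Module.End k (ProdChain k i))) (C i)) := by
  -- The operator on `C i` has index `i + 1`, so it is `τ × τ - 1` for odd `i` and the norm for even
  -- `i`.
  refine ⟨fun i => realizePair k p hp i (listHomotopy k p i), fun i => ⟨fun hi => ?_, fun hi => ?_⟩⟩
  · have h : ∀ x : Finset.HasAntidiagonal.antidiagonal i, _ := fun x =>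
      realizePair_listDiagTerm_odd (k := k) p hp
        (Finset.HasAntidiagonal.mem_antidiagonal.1 x.2) hi
    rw [boundary_realizePair_listHomotopy, Fintype.sum_congr _ _ h, Finset.sum_add_distrib,
      cyclicOp_even (by simpa [Nat.even_add_one] using hi), ← sub_sub]
  · have h : ∀ x : Finset.HasAntidiagonal.antidiagonal i, _ := fun x =>
      realizePair_listDiagTerm_even (k := k) p hp
        (Finset.HasAntidiagonal.mem_antidiagonal.1 x.2) hi
    rw [boundary_realizePair_listHomotopy, Fintype.sum_congr _ _ h, Finset.sum_add_distrib,
      cyclicOp_odd (by simpa [Nat.even_add_one] using hi), ← sub_sub]
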